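/- Let $I=\{\mathsf{nop},\mathsf{inp},\mathsf{out},\mathsf{set},\mathsf{res},\mathsf{swap},\mathsf{used},\mathsf{free}\}$ be the set of Boolean interactions, that is, of the following partial functions on $\{0,1\}$: $\mathsf{nop}(x)=x$, $\mathsf{set}(x)=1$, $\mathsf{res}(x)=0$, $\mathsf{swap}(x)=1-x$ for all $x$; $\mathsf{inp}$ is defined only at $1$ with $\mathsf{inp}(1)=0$; $\mathsf{out}$ is defined only at $0$ with $\mathsf{out}(0)=1$; $\mathsf{used}$ is defined only at $1$ with $\mathsf{used}(1)=1$; $\mathsf{free}$ is defined only at $0$ with $\mathsf{free}(0)=0$. An (initialized) transition system $A=(S,E,\delta,s_0)$ consists of finite sets $S$ of states and $E$ of events, a partial function $\delta:S\times E\to S$ and a state $s_0$ from which every state is reachable; a triple $(s,e,s')$ with $\delta(s,e)=s'$ is an arc from $s$ to $s'$. $A$ is $g$-bounded if every state has at most $g$ incoming and at most $g$ outgoing arcs. For $\tau\subseteq I$, a $\tau$-net consists of finite sets $P$ of places and $T$ of transitions, an initial marking $H_0:P\to\{0,1\}$ and a function $f:P\times T\to\tau$. A transition $t$ can fire in a marking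 $M:P\to\{0,1\}$ if $f(p,t)$ is defined at $M(p)$ for all $p\in P$, and it then produces the marking $M'$ with $M'(p)=f(p,t)(M(p))$ for all $p$. The reachability graph of the net is the transition system of the markings reachable from $H_0$, with events $T$ and initial state $H_0$. $A$ is $\tau$-solvable if it is isomorphic (by bijections of the states and of the events that preserve $\delta$ and the initial state) to the reachability graph of some $\tau$-net. Theorem. Let $g\in\{0,1\}$ be fixed, and let $\tau$ be one of $\{\mathsf{nop},\mathsf{inp},\mathsf{set}\}$, $\{\mathsf{nop},\mathsf{inp},\mathsf{set},\mathsf{used}\}$, $\{\mathsf{nop},\mathsf{out},\mathsf{res}\}$, $\{\mathsf{nop},\mathsf{out},\mathsf{res},\mathsf{free}\}$, or $\{\mathsf{nop},\mathsf{set},\mathsf{res}\}\cup\omega$ with nonempty $\omega\subseteq\{\mathsf{inp},\mathsf{out},\mathsf{used},\mathsf{free}\}$. Then there is a deterministic (multi-stack) Turing machine that decides, for every given $g$-bounded initialized transition system $A$, whether $A$ is $\tau$-solvable, in time polynomial in the length of the encoding of $A$ (lists of its states, its events, its arcs and its initial state, with names written in binary). -/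

import Mathlib

namespace BoolNet

/-- The eight Boolean interactions. -/
inductive Interaction where
  | nop | inp | out | set | res | swap | used | free
  deriving DecidableEq

/-- The partial function `{0,1} → {0,1}` denoted by an interaction (`none`: undefined). -/
def Interaction.app : Interaction → Bool → Option Bool
  | .nop, x => some x
  | .inp, true => some false
  | .inp, false => none
  | .out, false => some true
  | .out, true => none
  | .set, _ => some true
  | .res, _ => some false
  | .swap, x => some (!x)
  | .used, true => some true
  | .used, false => none
  | .free, false => some false
  | .free, true => none

/-- An initialized (deterministic) transition system with states `S` and events `E`: a partial
transition function and an initial state from which every state is reachable. -/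
structure InitTS (S E : Type) where
  /-- the partial transition function -/
  δ : S → E → Option S
  /-- the initial state -/
  s₀ : S
  /-- every state is reachable by a directed path -/
  reachable : ∀ s, Relation.ReflTransGen (fun a b => ∃ e, δ a e = some b) s₀ s

/-- Every state has at most `g` incoming and at most `g` outgoing arcs. -/
def InitTS.IsBounded {S E : Type} (A : InitTS S E) (g : ℕ) : Prop :=
  ∀ s : S, {a : S × E | A.δ a.1 a.2 = some s}.encard ≤ g ∧
    {e : E | (A.δ s e).isSome}.encard ≤ g

/-- Isomorphisms of initialized transition systems. -/
structure InitTS.Iso {S E S' E' : Type} (A : InitTS S E) (B : InitTS S' E') where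
  /-- the bijection of the states -/
  onStates : S ≃ S'
  /-- the bijection of the events -/
  onEvents : E ≃ E'
  map_init : onStates A.s₀ = B.s₀
  map_δ : ∀ s e, B.δ (onStates s) (onEvents e) = (A.δ s e).map onStates

/-- A `τ`-net with places `P` and transitions `T`, for a Boolean type of nets `τ`. -/
structure Net (τ : Set Interaction) (P T : Type) where
  /-- the initial marking -/
  H₀ : P → Bool
  /-- the flow function -/
  f : P → T → τ

namespace Net

variable {τ : Set Interaction} {P T : Type}

open Classical in
/-- The marking produced by firing `t` in `M`, if `t` can fire in `M`. -/
noncomputable def fire (N : Net τ P T) (M : P → Bool) (t : T) : Option (P → Bool) :=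
  if h : ∀ p, ((N.f p t : Interaction).app (M p)).isSome then
    some fun p => ((N.f p t : Interaction).app (M p)).get (h p)
  else none

/-- `M` is reachable from the initial marking by firing a sequence of transitions. -/
def IsReachable (N : Net τ P T) (M : P → Bool) : Prop :=
  Relation.ReflTransGen (fun M M' => ∃ t, N.fire M t = some M') N.H₀ M

theorem IsReachable.fire {N : Net τ P T} {M M' : P → Bool} {t : T} (hM : N.IsReachable M)
    (h : N.fire M t = some M') : N.IsReachable M' :=
  Relation.ReflTransGen.tail hM ⟨t, h⟩

theorem isReachable_init (N : Net τ P T) : N.IsReachable N.H₀ :=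
  Relation.ReflTransGen.refl

/-- The reachability graph of a net. -/
noncomputable def reachabilityGraph (N : Net τ P T) :
    InitTS {M : P → Bool // N.IsReachable M} T where
  δ M t := (N.fire M.1 t).pmap (fun M' h => ⟨M', M.2.fire h⟩) (fun _ h => h)
  s₀ := ⟨N.H₀, N.isReachable_init⟩
  reachable := by
    rintro ⟨M, hM⟩
    induction hM with
    | refl => exact Relation.ReflTransGen.refl
    | tail hM hstep ih =>
      refine ih.tail ?_
      obtain ⟨t, ht⟩ := hstep
      exact ⟨t, by simp [ht]⟩

end Net

/-- `A` is `τ`-solvable: it is isomorphic to the reachability graph of a `τ`-net. -/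
def InitTS.Solvable {S E : Type} (A : InitTS S E) (τ : Set Interaction) : Prop :=
  ∃ (P T : Type) (_ : Finite P) (_ : Finite T) (N : Net τ P T),
    Nonempty (A.Iso N.reachabilityGraph)

/-- A finite initialized transition system as an input of an algorithm: its states and its events
are numbered consecutively, in any order. -/
structure FinTS where
  /-- the number of states -/
  n : ℕ
  /-- the number of events -/
  m : ℕ
  /-- the transition system -/
  ts : InitTS (Fin n) (Fin m)

namespace FinTS

open Computability

/-- The arcs `(s, e, s')` of a finite transition system. -/
def arcs (A : FinTS) : List (Fin A.n × Fin A.m × Fin A.n) :=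
  (List.finRange A.n).flatMap fun s =>
    (List.finRange A.m).filterMap fun e => (A.ts.δ s e).map fun s' => (s, e, s')

/-- A list of numbers in binary, each followed by a comma, in brackets. -/
def encodeBlock (l : List ℕ) : List Γ' :=
  Γ'.bra :: l.flatMap (fun k => encodingNatΓ'.encode k ++ [Γ'.comma]) ++ [Γ'.ket]

/-- The word that describes a finite transition system: the states, the events, the arcs (source,
event, sink) and the initial state, with all names in binary. -/
def encode (A : FinTS) : List Γ' :=
  encodeBlock ((List.finRange A.n).map fun s => (s : ℕ)) ++
  encodeBlock ((List.finRange A.m).map fun e => (e : ℕ)) ++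
  encodeBlock (A.arcs.flatMap fun a => [(a.1 : ℕ), (a.2.1 : ℕ), (a.2.2 : ℕ)]) ++
  encodeBlock [(A.ts.s₀ : ℕ)]

end FinTS

/-- The property `p` of the elements of `α`, presented as words by `enc`, is decided by a Turing
machine (a multi-stack machine with finite control) in time polynomial in the length of the
word. -/
def PolyTimeDecidable {α Γ : Type} (enc : α → List Γ) (p : α → Prop) : Prop :=
  ∃ f : α → Bool, (∀ a, f a = true ↔ p a) ∧
    Nonempty (Turing.TM2ComputableInPolyTime enc Computability.encodeBool f)

end BoolNet

/-!
The theorem holds because a transition system with at most one arc into and out of each state is a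
path or a cycle, for which the solvability is a property of the word of its events that a stack
machine can check in polynomial time.

*Regions.* A place of a net that solves `A` restricts to a region of `A`: a set of states together
with an interaction for each event that maps the membership of the source of an arc to that of its
sink. Conversely, the regions with interactions in `τ` are the places of a net, which solves `A` if
and only if the regions separate any two states and prevent every event at every state that does not
enable it (`InitTS.solvable_iff`). Complements of regions are regions for the dual interactions, so
that the types with `out` and `res` reduce to those with `inp` and `set`.

*The criterion.* Let a region of a path or cycle avoid the state at the position `s` of the word `W`
but not all states. Let `p` be the last position before `s` where the region is left, or where a
path has no past. The letters between `p` and `s` do not change the membership in the region, as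
a region that is entered stays entered until it is left. It follows that the region contains no
state that is reached after an occurrence of `W p` by letters between `p` and `s` alone
(`IsWordRegion.exists_outside`); the same applies to an event with the interaction `inp` in place of
`W p`. On the other hand, the set of all states not excluded in this way is a region, with `nop` for
the letters between `p` and `s`, with `inp` or `res` for `W p`, and with `set` for all other letters
(`IsWordOf.exists_isRegion_of_outside`). Hence, only these largest regions need to be considered, one
for each `p`. The result is the criterion `Accept`, a formula with quantifiers over positions
(`IsAdmissible.solvable_iff`). For types without `res`, the letter `W p` has to have the interaction
`inp`, so that its sources have to be in the region. If `res` is available, there is no such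
condition; as membership in `τ` of `inp` or `out`, and of `used` or `free`, is all that matters
then, the criterion covers every `ω`.

*The running time.* A class `PT` of functions of the input word and of numbers bounded by its length
is closed under composition, bounded quantifiers, and bounded recursion. Each function of the class
is computed by a while program with registers, in polynomial time. While programs are translated to
stack machines step by step (`Exec.stepN`), with the registers as unary stacks. All of the criterion,
including the parsing of the input and the traversal of the transition system, is expressed in this
class (`PTP.accept`), whence `PT.polyTimeDecidable` gives the machine.
-/

open Computability Turing

namespace BoolNet

/-! ### A while language for stack machines -/

/-- The memory of a while program: the input, split at the reading head into the part to the right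
of the head (`inp`) and the reversed part to its left (`aux`), the output, and registers that hold
natural numbers. -/
structure Mem where
  /-- the part of the input to the right of the head -/
  inp : List Γ'
  /-- the part of the input to the left of the head, reversed -/
  aux : List Γ'
  /-- the output -/
  out : List Bool
  /-- the registers -/
  reg : ℕ → ℕ

/-- The elementary instructions: changing a register by one, moving the head, erasing the symbol
under the head, and writing a bit of output. -/
inductive Instr where
  | inc (x : ℕ)
  | dec (x : ℕ)
  | shiftR
  | shiftL
  | erase
  | emit (b : Bool)

/-- The effect of an elementary instruction. A head that is moved beyond the input reads a blank. -/
def Instr.apply : Instr → Mem → Mem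
  | .inc x, M => { M with reg := Function.update M.reg x (M.reg x + 1) }
  | .dec x, M => { M with reg := Function.update M.reg x (M.reg x - 1) }
  | .shiftR, M => { M with inp := M.inp.tail, aux := M.inp.head?.getD .blank :: M.aux }
  | .shiftL, M => { M with inp := M.aux.head?.getD .blank :: M.inp, aux := M.aux.tail }
  | .erase, M => { M with inp := M.inp.tail }
  | .emit b, M => { M with out := b :: M.out }

/-- The tests: whether a register is positive, whether the input on either side of the head is
nonempty, and whether the head reads a given symbol. -/
inductive Test where
  | reg (x : ℕ)
  | inp
  | aux
  | sym (c : Γ')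

/-- The outcome of a test. -/
def Test.eval : Test → Mem → Bool
  | .reg x, M => M.reg x != 0
  | .inp, M => M.inp.head?.isSome
  | .aux, M => M.aux.head?.isSome
  | .sym c, M => M.inp.head? == some c

/-- While programs. -/
inductive Prog where
  | instr (o : Instr)
  | seq (p q : Prog)
  | ite (T : Test) (p q : Prog)
  | loop (T : Test) (p : Prog)

/-- `Exec p M M' t`: the program `p`, started in the memory `M`, terminates with the memory `M'`
after `t` steps. -/
inductive Exec : Prog → Mem → Mem → ℕ → Prop
  | instr (o : Instr) (M : Mem) : Exec (.instr o) M (o.apply M) 1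
  | seq {p q : Prog} {M M' M'' : Mem} {t t' : ℕ} :
      Exec p M M' t → Exec q M' M'' t' → Exec (.seq p q) M M'' (t + t')
  | ite_true {T : Test} {p q : Prog} {M M' : Mem} {t : ℕ} :
      T.eval M = true → Exec p M M' t → Exec (.ite T p q) M M' (t + 1)
  | ite_false {T : Test} {p q : Prog} {M M' : Mem} {t : ℕ} :
      T.eval M = false → Exec q M M' t → Exec (.ite T p q) M M' (t + 1)
  | loop_false {T : Test} {p : Prog} {M : Mem} :
      T.eval M = false → Exec (.loop T p) M M 1
  | loop_true {T : Test} {p : Prog} {M M' M'' : Mem} {t t' : ℕ} :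
      T.eval M = true → Exec p M M' t → Exec (.loop T p) M' M'' t' →
        Exec (.loop T p) M M'' (t + t' + 1)

/-! ### While programs as stack machines -/

/-- The stacks of the machine of a program whose registers are numbered from `0` to `D`. -/
inductive Stk (D : ℕ) where
  | inp
  | aux
  | out
  | reg (i : Fin (D + 1))
  deriving DecidableEq, Fintype

/-- The stack alphabets. A register is a stack over a one-letter alphabet. -/
def Stk.Alphabet {D : ℕ} : Stk D → Type
  | .inp => Γ'
  | .aux => Γ'
  | .out => Bool
  | .reg _ => Unit

/-- The contents of the stacks that represent a memory. -/
def Mem.stk (D : ℕ) (M : Mem) : ∀ k : Stk D, List k.Alphabet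
  | .inp => M.inp
  | .aux => M.aux
  | .out => M.out
  | .reg i => List.replicate (M.reg i) ()

/-- The largest register named by an instruction. -/
def Instr.maxReg : Instr → ℕ
  | .inc x => x
  | .dec x => x
  | _ => 0

/-- The largest register named by a test. -/
def Test.maxReg : Test → ℕ
  | .reg x => x
  | _ => 0

/-- The largest register named by a program. -/
def Prog.maxReg : Prog → ℕ
  | .instr o => o.maxReg
  | .seq p q => max p.maxReg q.maxReg
  | .ite T p q => max T.maxReg (max p.maxReg q.maxReg)
  | .loop T p => max T.maxReg p.maxReg

section Compile

variable {D : ℕ} {Λ : Type}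

/-- The machine statement that performs an instruction and continues with `s`. The finite control
holds the symbol that was read last. -/
def Instr.stmt (o : Instr) (s : TM2.Stmt (Stk.Alphabet (D := D)) Λ (Option Γ')) :
    TM2.Stmt (Stk.Alphabet (D := D)) Λ (Option Γ') :=
  match o with
  | .inc x => .push (.reg (Fin.ofNat (D + 1) x)) (fun _ => ()) s
  | .dec x => .pop (.reg (Fin.ofNat (D + 1) x)) (fun v _ => v) s
  | .shiftR => .pop .inp (fun _ a => a) (.push .aux (fun v => v.getD .blank) s)
  | .shiftL => .pop .aux (fun _ a => a) (.push .inp (fun v => v.getD .blank) s)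
  | .erase => .pop .inp (fun v _ => v) s
  | .emit b => .push .out (fun _ => b) s

/-- The machine statement that performs a test and continues with `s₁` or `s₂`. -/
def Test.stmt (T : Test) (s₁ s₂ : TM2.Stmt (Stk.Alphabet (D := D)) Λ (Option Γ')) :
    TM2.Stmt (Stk.Alphabet (D := D)) Λ (Option Γ') :=
  match T with
  | .reg x => .peek (.reg (Fin.ofNat (D + 1) x)) (fun _ a => a.map fun _ => .blank)
      (.branch (fun v => v.isSome) s₁ s₂)
  | .inp => .peek .inp (fun _ a => a) (.branch (fun v => v.isSome) s₁ s₂)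
  | .aux => .peek .aux (fun _ a => a) (.branch (fun v => v.isSome) s₁ s₂)
  | .sym c => .peek .inp (fun _ a => a) (.branch (fun v => v == some c) s₁ s₂)

theorem Instr.stepAux_stmt (o : Instr) (ho : o.maxReg ≤ D)
    (s : TM2.Stmt (Stk.Alphabet (D := D)) Λ (Option Γ')) (v : Option Γ') (M : Mem) :
    ∃ v', TM2.stepAux (o.stmt s) v (M.stk D) = TM2.stepAux s v' ((o.apply M).stk D) := by
  cases o with
  | inc x =>
    refine ⟨v, ?_⟩
    obtain ⟨i, hi, rfl⟩ : ∃ i : Fin (D + 1), Fin.ofNat (D + 1) x = i ∧ (i : ℕ) = x :=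
      ⟨_, rfl, Nat.mod_eq_of_lt (Nat.lt_succ_of_le ho)⟩
    have hs : (Instr.inc (i : ℕ)).stmt s = .push (.reg i) (fun _ => ()) s := by
      rw [Instr.stmt, hi]
    simp only [hs, TM2.stepAux]
    congr 1
    funext k
    cases k with
    | reg j =>
      by_cases h : j = i
      · subst h
        rw [Function.update_self]
        simp only [Mem.stk, Instr.apply, Function.update_self]
        rfl
      · have h' : (j : ℕ) ≠ i := fun e => h (Fin.ext e)
        rw [Function.update_of_ne (by simpa using h)]
        simp only [Mem.stk, Instr.apply, Function.update_of_ne h']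
    | _ => rfl
  | dec x =>
    refine ⟨v, ?_⟩
    obtain ⟨i, hi, rfl⟩ : ∃ i : Fin (D + 1), Fin.ofNat (D + 1) x = i ∧ (i : ℕ) = x :=
      ⟨_, rfl, Nat.mod_eq_of_lt (Nat.lt_succ_of_le ho)⟩
    have hs : (Instr.dec (i : ℕ)).stmt s = .pop (.reg i) (fun v _ => v) s := by
      rw [Instr.stmt, hi]
    simp only [hs, TM2.stepAux]
    congr 1
    funext k
    cases k with
    | reg j =>
      by_cases h : j = i
      · subst h
        rw [Function.update_self]
        simp only [Mem.stk, Instr.apply, Function.update_self]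
        exact List.tail_replicate
      · have h' : (j : ℕ) ≠ i := fun e => h (Fin.ext e)
        rw [Function.update_of_ne (by simpa using h)]
        simp only [Mem.stk, Instr.apply, Function.update_of_ne h']
    | _ => rfl
  | shiftR =>
    refine ⟨M.inp.head?, ?_⟩
    simp only [Instr.stmt, TM2.stepAux]
    congr 1
    funext k
    cases k <;> rfl
  | shiftL =>
    refine ⟨M.aux.head?, ?_⟩
    simp only [Instr.stmt, TM2.stepAux]
    congr 1
    funext k
    cases k <;> rfl
  | erase =>
    refine ⟨v, ?_⟩
    simp only [Instr.stmt, TM2.stepAux]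
    congr 1
    funext k
    cases k <;> rfl
  | emit b =>
    refine ⟨v, ?_⟩
    simp only [Instr.stmt, TM2.stepAux]
    congr 1
    funext k
    cases k <;> rfl

theorem Test.stepAux_stmt (T : Test) (hT : T.maxReg ≤ D)
    (s₁ s₂ : TM2.Stmt (Stk.Alphabet (D := D)) Λ (Option Γ')) (v : Option Γ') (M : Mem) :
    ∃ v', TM2.stepAux (T.stmt s₁ s₂) v (M.stk D) =
      cond (T.eval M) (TM2.stepAux s₁ v' (M.stk D)) (TM2.stepAux s₂ v' (M.stk D)) := by
  cases T with
  | reg x =>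
    refine ⟨Option.map (fun _ => Γ'.blank) (M.stk D (.reg (Fin.ofNat (D + 1) x))).head?, ?_⟩
    simp only [Test.stmt, TM2.stepAux]
    have hx : ((Fin.ofNat (D + 1) x : Fin (D + 1)) : ℕ) = x :=
      Nat.mod_eq_of_lt (Nat.lt_succ_of_le hT)
    have : (Option.map (fun _ => Γ'.blank)
        (M.stk D (.reg (Fin.ofNat (D + 1) x))).head?).isSome = Test.eval (.reg x) M := by
      simp only [Mem.stk, hx, Test.eval]
      cases M.reg x <;> rfl
    rw [this]
  | inp => exact ⟨_, rfl⟩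
  | aux => exact ⟨_, rfl⟩
  | sym c => exact ⟨_, rfl⟩

/-- The labels of the machine of a program: one for each instruction and each test in it. -/
def Prog.Label : Prog → Type
  | .instr _ => Unit
  | .seq p q => p.Label ⊕ q.Label
  | .ite _ p q => Option (p.Label ⊕ q.Label)
  | .loop _ p => Option p.Label

instance Prog.fintypeLabel : ∀ p : Prog, Fintype p.Label
  | .instr _ => inferInstanceAs (Fintype Unit)
  | .seq p q =>
    have := fintypeLabel p
    have := fintypeLabel q
    inferInstanceAs (Fintype (p.Label ⊕ q.Label))
  | .ite _ p q =>
    have := fintypeLabel p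
    have := fintypeLabel q
    inferInstanceAs (Fintype (Option (p.Label ⊕ q.Label)))
  | .loop _ p =>
    have := fintypeLabel p
    inferInstanceAs (Fintype (Option p.Label))

/-- The label at which the execution of a program starts. -/
def Prog.start : ∀ p : Prog, p.Label
  | .instr _ => ()
  | .seq p _ => Sum.inl p.start
  | .ite _ _ _ => none
  | .loop _ _ => none

/-- The statements of a program that is part of a machine with labels `Λ`, where `emb` tells which
labels belong to the program, and `exit` is the label at which the machine continues after the
program. -/
def Prog.code : ∀ p : Prog, (p.Label → Λ) → Λ → p.Label →
    TM2.Stmt (Stk.Alphabet (D := D)) Λ (Option Γ')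
  | .instr o, _, exit, _ => o.stmt (.goto fun _ => exit)
  | .seq p q, emb, _, .inl l => p.code (emb ∘ Sum.inl) (emb (.inr q.start)) l
  | .seq _ q, emb, exit, .inr l => q.code (emb ∘ Sum.inr) exit l
  | .ite T p q, emb, _, none =>
    T.stmt (.goto fun _ => emb (some (.inl p.start))) (.goto fun _ => emb (some (.inr q.start)))
  | .ite _ p _, emb, exit, some (.inl l) => p.code (emb ∘ some ∘ Sum.inl) exit l
  | .ite _ _ q, emb, exit, some (.inr l) => q.code (emb ∘ some ∘ Sum.inr) exit l
  | .loop T p, emb, exit, none =>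
    T.stmt (.goto fun _ => emb (some p.start)) (.goto fun _ => exit)
  | .loop _ p, emb, _, some l => p.code (emb ∘ some) (emb none) l

/-- The configuration after `t` steps, if the machine has not halted before. -/
def stepN (m : Λ → TM2.Stmt (Stk.Alphabet (D := D)) Λ (Option Γ')) (t : ℕ)
    (c : Option (TM2.Cfg (Stk.Alphabet (D := D)) Λ (Option Γ'))) :
    Option (TM2.Cfg (Stk.Alphabet (D := D)) Λ (Option Γ')) :=
  (fun c => c.bind (TM2.step m))^[t] c

theorem stepN_add (m : Λ → TM2.Stmt (Stk.Alphabet (D := D)) Λ (Option Γ')) (t t' : ℕ)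
    (c : Option (TM2.Cfg (Stk.Alphabet (D := D)) Λ (Option Γ'))) :
    stepN m (t + t') c = stepN m t' (stepN m t c) := by
  rw [add_comm, stepN, Function.iterate_add_apply]
  rfl

theorem stepN_one (m : Λ → TM2.Stmt (Stk.Alphabet (D := D)) Λ (Option Γ')) (l : Λ)
    (v : Option Γ') (S : ∀ k : Stk D, List k.Alphabet) :
    stepN m 1 (some ⟨some l, v, S⟩) = some (TM2.stepAux (m l) v S) :=
  rfl

/-- The machine simulates the program step by step. -/
theorem Exec.stepN {p : Prog} {M M' : Mem} {t : ℕ} (h : Exec p M M' t) (hp : p.maxReg ≤ D)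
    (m : Λ → TM2.Stmt (Stk.Alphabet (D := D)) Λ (Option Γ')) (emb : p.Label → Λ) (exit : Λ)
    (hm : ∀ l, m (emb l) = p.code emb exit l) (v : Option Γ') :
    ∃ v', BoolNet.stepN m t (some ⟨some (emb p.start), v, M.stk D⟩) =
      some ⟨some exit, v', M'.stk D⟩ := by
  induction h generalizing exit v with
  | instr o M =>
    obtain ⟨v', h⟩ := o.stepAux_stmt hp (.goto fun _ => exit) v M
    refine ⟨v', ?_⟩
    have hm' : m (emb (Prog.instr o).start) = o.stmt (.goto fun _ => exit) := hm _
    rw [stepN_one, hm', h]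
    rfl
  | @seq p q _ _ _ _ _ _ _ ih₁ ih₂ =>
    simp only [Prog.maxReg, max_le_iff] at hp
    obtain ⟨v₁, h₁⟩ := ih₁ hp.1 (emb ∘ Sum.inl) (emb (.inr q.start)) (fun l => hm (.inl l)) v
    obtain ⟨v₂, h₂⟩ := ih₂ hp.2 (emb ∘ Sum.inr) exit (fun l => hm (.inr l)) v₁
    refine ⟨v₂, ?_⟩
    rw [stepN_add, ← h₂]
    exact congrArg _ h₁
  | @ite_true T p q M _ _ hT _ ih =>
    simp only [Prog.maxReg, max_le_iff] at hp
    obtain ⟨v₁, h₁⟩ := T.stepAux_stmt hp.1 (.goto fun _ => emb (some (.inl p.start)))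
      (.goto fun _ => emb (some (.inr q.start))) v M
    obtain ⟨v₂, h₂⟩ := ih hp.2.1 (emb ∘ some ∘ Sum.inl) exit (fun l => hm (some (.inl l))) v₁
    refine ⟨v₂, ?_⟩
    have hm' : m (emb (Prog.ite T p q).start) = T.stmt (.goto fun _ => emb (some (.inl p.start)))
        (.goto fun _ => emb (some (.inr q.start))) := hm none
    rw [add_comm, stepN_add, ← h₂, stepN_one, hm', h₁, hT]
    rfl
  | @ite_false T p q M _ _ hT _ ih =>
    simp only [Prog.maxReg, max_le_iff] at hp
    obtain ⟨v₁, h₁⟩ := T.stepAux_stmt hp.1 (.goto fun _ => emb (some (.inl p.start)))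
      (.goto fun _ => emb (some (.inr q.start))) v M
    obtain ⟨v₂, h₂⟩ := ih hp.2.2 (emb ∘ some ∘ Sum.inr) exit (fun l => hm (some (.inr l))) v₁
    refine ⟨v₂, ?_⟩
    have hm' : m (emb (Prog.ite T p q).start) = T.stmt (.goto fun _ => emb (some (.inl p.start)))
        (.goto fun _ => emb (some (.inr q.start))) := hm none
    rw [add_comm, stepN_add, ← h₂, stepN_one, hm', h₁, hT]
    rfl
  | @loop_false T p M hT =>
    simp only [Prog.maxReg, max_le_iff] at hp
    obtain ⟨v₁, h₁⟩ := T.stepAux_stmt hp.1 (.goto fun _ => emb (some p.start))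
      (.goto fun _ => exit) v M
    refine ⟨v₁, ?_⟩
    have hm' : m (emb (Prog.loop T p).start) = T.stmt (.goto fun _ => emb (some p.start))
        (.goto fun _ => exit) := hm none
    rw [stepN_one, hm', h₁, hT]
    rfl
  | @loop_true T p M _ _ _ _ hT _ _ ih₁ ih₂ =>
    have hp' := hp
    simp only [Prog.maxReg, max_le_iff] at hp
    obtain ⟨v₀, h₀⟩ := T.stepAux_stmt hp.1 (.goto fun _ => emb (some p.start))
      (.goto fun _ => exit) v M
    obtain ⟨v₁, h₁⟩ := ih₁ hp.2 (emb ∘ some) (emb none) (fun l => hm (some l)) v₀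
    obtain ⟨v₂, h₂⟩ := ih₂ hp' emb exit hm v₁
    refine ⟨v₂, ?_⟩
    rw [add_comm, stepN_add, stepN_add, ← h₂]
    have hm' : m (emb (Prog.loop T p).start) = T.stmt (.goto fun _ => emb (some p.start))
        (.goto fun _ => exit) := hm none
    have : BoolNet.stepN m 1 (some ⟨some (emb (Prog.loop T p).start), v, M.stk D⟩) =
        some ⟨some (emb (some p.start)), v₀, M.stk D⟩ := by
      rw [stepN_one, hm', h₀, hT]
      rfl
    rw [this]
    exact congrArg _ h₁

end Compile

/-- The machine of a program. The label `none` is the one at which it halts. -/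
def Prog.machine (p : Prog) : FinTM2 where
  K := Stk p.maxReg
  k₀ := .inp
  k₁ := .out
  Γ := Stk.Alphabet
  Λ := Option p.Label
  main := some p.start
  σ := Option Γ'
  initialState := none
  Γk₀Fin := inferInstanceAs (Fintype Γ')
  m
    | some l => p.code some none l
    | none => .load (fun _ => none) .halt

/-- A program that computes, within a polynomial number of steps, the bit `f a` from the word `enc a`
and leaves all else empty, yields a decision procedure by a Turing machine. -/
theorem polyTimeDecidable_of_prog {α : Type} (enc : α → List Γ') (P : α → Prop) (f : α → Bool)
    (hf : ∀ a, f a = true ↔ P a) (p : Prog) (T : Polynomial ℕ)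
    (h : ∀ a, ∃ t ≤ T.eval (enc a).length,
      Exec p ⟨enc a, [], [], fun _ => 0⟩ ⟨[], [], [f a], fun _ => 0⟩ t) :
    PolyTimeDecidable enc P := by
  refine ⟨f, hf, ⟨⟨⟨p.machine, Equiv.refl _, Equiv.refl _⟩, T + 1, fun a => ?_⟩⟩⟩
  choose t ht hE using h
  refine ⟨⟨t a + 1, ?_⟩, ?_⟩
  · obtain ⟨v, hv⟩ := (hE a).stepN le_rfl p.machine.m some none (fun _ => rfl) none
    have h0 : initList p.machine (List.map (Equiv.refl Γ').invFun (enc a)) =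
        ⟨some (some p.start), none, Mem.stk p.maxReg ⟨enc a, [], [], fun _ => 0⟩⟩ := by
      refine congrArg (TM2.Cfg.mk _ _) ?_
      funext k
      cases k with
      | inp => exact List.map_id _
      | _ => rfl
    have h1 : haltList p.machine (List.map (Equiv.refl Bool).invFun (encodeBool (f a))) =
        ⟨none, none, Mem.stk p.maxReg ⟨[], [], [f a], fun _ => 0⟩⟩ := by
      refine congrArg (TM2.Cfg.mk _ _) ?_
      funext k
      cases k with
      | out => exact List.map_id _
      | _ => rfl
    rw [Option.map_some]
    refine Eq.trans ?_ (congrArg some h1.symm)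
    have := stepN_add p.machine.m (t a) 1
      (some ⟨some (some p.start), none, Mem.stk p.maxReg ⟨enc a, [], [], fun _ => 0⟩⟩)
    rw [hv] at this
    refine Eq.trans ?_ (this.trans ?_)
    · exact congrArg (fun c => stepN p.machine.m (t a + 1) (some c)) h0
    · rfl
  · rw [Polynomial.eval_add, Polynomial.eval_one]
    exact Nat.add_le_add_right (ht a) 1

/-! ### Running while programs with a time bound -/

/-- `p` takes the memory `M` to the memory `M'` in at most `n` steps. -/
def Runs (p : Prog) (M M' : Mem) (n : ℕ) : Prop :=
  ∃ t ≤ n, Exec p M M' t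

/-- The memory with the head at the beginning of the input `w` and with registers `R`. -/
abbrev mem (w : List Γ') (R : ℕ → ℕ) : Mem :=
  ⟨w, [], [], R⟩

theorem Runs.mono {p : Prog} {M M' : Mem} {n n' : ℕ} (h : Runs p M M' n) (hn : n ≤ n') :
    Runs p M M' n' :=
  let ⟨t, ht, hE⟩ := h
  ⟨t, ht.trans hn, hE⟩

theorem Runs.instr (o : Instr) (M : Mem) : Runs (.instr o) M (o.apply M) 1 :=
  ⟨1, le_rfl, .instr o M⟩

theorem Runs.seq {p q : Prog} {M M' M'' : Mem} {n n' : ℕ} (h : Runs p M M' n)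
    (h' : Runs q M' M'' n') : Runs (.seq p q) M M'' (n + n') :=
  let ⟨_, ht, hE⟩ := h
  let ⟨_, ht', hE'⟩ := h'
  ⟨_, Nat.add_le_add ht ht', .seq hE hE'⟩

theorem Runs.ite_true {T : Test} {p q : Prog} {M M' : Mem} {n : ℕ} (hT : T.eval M = true)
    (h : Runs p M M' n) : Runs (.ite T p q) M M' (n + 1) :=
  let ⟨_, ht, hE⟩ := h
  ⟨_, Nat.add_le_add_right ht 1, .ite_true hT hE⟩

theorem Runs.ite_false {T : Test} {p q : Prog} {M M' : Mem} {n : ℕ} (hT : T.eval M = false)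
    (h : Runs q M M' n) : Runs (.ite T p q) M M' (n + 1) :=
  let ⟨_, ht, hE⟩ := h
  ⟨_, Nat.add_le_add_right ht 1, .ite_false hT hE⟩

/-- A loop whose body takes the memories `Ms 0`, …, `Ms n` to one another. -/
theorem Runs.loop {T : Test} {p : Prog} {c : ℕ} (n : ℕ) (Ms : ℕ → Mem)
    (hT : ∀ i < n, T.eval (Ms i) = true) (hT' : T.eval (Ms n) = false)
    (h : ∀ i < n, Runs p (Ms i) (Ms (i + 1)) c) :
    Runs (.loop T p) (Ms 0) (Ms n) (n * (c + 1) + 1) := by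
  induction n generalizing Ms with
  | zero => exact ⟨1, by simp, .loop_false hT'⟩
  | succ n ih =>
    obtain ⟨t, ht, hE⟩ := h 0 n.succ_pos
    obtain ⟨t', ht', hE'⟩ := ih (fun i => Ms (i + 1)) (fun i hi => hT (i + 1) (by omega)) hT'
      (fun i hi => h (i + 1) (by omega))
    refine ⟨t + t' + 1, ?_, .loop_true (hT 0 n.succ_pos) hE hE'⟩
    rw [Nat.succ_mul]
    omega

theorem Test.eval_reg_eq_true {x : ℕ} {M : Mem} : (Test.reg x).eval M = true ↔ M.reg x ≠ 0 := by
  simp [Test.eval]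

theorem Test.eval_reg_eq_false {x : ℕ} {M : Mem} : (Test.reg x).eval M = false ↔ M.reg x = 0 := by
  simp [Test.eval]

/-- The program that sets the register `x` to zero. -/
def Prog.clear (x : ℕ) : Prog :=
  .loop (.reg x) (.instr (.dec x))

theorem Runs.clear (x : ℕ) (I A : List Γ') (O : List Bool) (R : ℕ → ℕ) :
    Runs (.clear x) ⟨I, A, O, R⟩ ⟨I, A, O, Function.update R x 0⟩ (R x * 2 + 1) := by
  have := Runs.loop (T := .reg x) (p := .instr (.dec x)) (c := 1) (R x)
    (fun i => ⟨I, A, O, Function.update R x (R x - i)⟩)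
    (fun i hi => by
      simp [Test.eval_reg_eq_true]
      omega)
    (by simp [Test.eval_reg_eq_false])
    (fun i hi => by
      convert Runs.instr (.dec x) _ using 1
      simp [Instr.apply, Nat.sub_sub])
  simp only [Nat.sub_zero, Nat.sub_self, Function.update_eq_self] at this
  exact this

/-- The program that moves the contents of the register `x` to the register `y`. -/
def Prog.move (x y : ℕ) : Prog :=
  .seq (.clear y) (.loop (.reg x) (.seq (.instr (.dec x)) (.instr (.inc y))))

theorem Runs.move {x y : ℕ} (hxy : x ≠ y) (I A : List Γ') (O : List Bool) (R : ℕ → ℕ) :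
    Runs (.move x y) ⟨I, A, O, R⟩
      ⟨I, A, O, Function.update (Function.update R x 0) y (R x)⟩ (R y * 2 + R x * 3 + 2) := by
  have := Runs.loop (T := .reg x) (p := .seq (.instr (.dec x)) (.instr (.inc y))) (c := 2) (R x)
    (fun i => ⟨I, A, O, Function.update (Function.update R x (R x - i)) y i⟩)
    (fun i hi => by
      simp [Test.eval_reg_eq_true, hxy]
      omega)
    (by simp [Test.eval_reg_eq_false, hxy])
    (fun i hi => by
      convert (Runs.instr (.dec x) _).seq (Runs.instr (.inc y) _) using 1
      simp only [Instr.apply]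
      congr 1
      funext r
      simp only [Function.update_apply]
      split_ifs <;> omega)
  simp only [Nat.sub_zero, Nat.sub_self, Function.update_eq_self] at this
  exact ((Runs.clear y I A O R).seq this).mono (by omega)

/-- The program that copies the register `x` to the register `y`, with the help of the
register `z`. -/
def Prog.copy (x y z : ℕ) : Prog :=
  .seq (.loop (.reg x) (.seq (.instr (.dec x)) (.seq (.instr (.inc y)) (.instr (.inc z)))))
    (.move z x)

theorem Runs.copy {x y z : ℕ} (hxy : x ≠ y) (hxz : x ≠ z) (hyz : y ≠ z) (I A : List Γ')
    (O : List Bool) (R : ℕ → ℕ) (hy : R y = 0) (hz : R z = 0) :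
    Runs (.copy x y z) ⟨I, A, O, R⟩ ⟨I, A, O, Function.update R y (R x)⟩ (R x * 7 + 3) := by
  -- The registers after `i` rounds of the loop that empties `x`.
  let Q : ℕ → ℕ → ℕ := fun i r => if r = x then R x - i else if r = y then i else
    if r = z then i else R r
  have h1 : Runs _ ⟨I, A, O, Q 0⟩ ⟨I, A, O, Q (R x)⟩ _ := Runs.loop (T := .reg x)
    (p := .seq (.instr (.dec x)) (.seq (.instr (.inc y)) (.instr (.inc z)))) (c := 3) (R x)
    (fun i => ⟨I, A, O, Q i⟩)
    (fun i hi => by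
      simp [Test.eval_reg_eq_true, Q]
      omega)
    (by simp [Test.eval_reg_eq_false, Q])
    (fun i hi => by
      convert (Runs.instr (.dec x) _).seq ((Runs.instr (.inc y) _).seq (Runs.instr (.inc z) _))
        using 1
      simp only [Instr.apply]
      congr 1
      funext r
      simp only [Function.update_apply, Q]
      split_ifs <;> omega)
  have h2 := Runs.move (x := z) (y := x) hxz.symm I A O (Q (R x))
  have e1 : Q 0 = R := by
    funext r
    simp only [Q]
    split_ifs <;> simp_all
  have e2 : Function.update (Function.update (Q (R x)) z 0) x (Q (R x) z) =
      Function.update R y (R x) := by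
    funext r
    simp only [Function.update_apply, Q]
    split_ifs <;> simp_all
  have e3 : Q (R x) x = 0 := by simp [Q]
  have e4 : Q (R x) z = R x := by simp [Q, hxz.symm, hyz.symm]
  rw [e1] at h1
  rw [e2, e3, e4] at h2
  exact (h1.seq h2).mono (by omega)

theorem Instr.apply_shiftR {w : List Γ'} {i : ℕ} (hi : i < w.length) (O : List Bool)
    (R : ℕ → ℕ) : Instr.shiftR.apply ⟨w.drop i, (w.take i).reverse, O, R⟩ =
      ⟨w.drop (i + 1), (w.take (i + 1)).reverse, O, R⟩ := by
  rw [List.take_succ_eq_append_getElem hi, List.reverse_append, List.drop_eq_getElem_cons hi]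
  rfl

theorem Instr.apply_shiftL {w : List Γ'} {i : ℕ} (hi : i < w.length) (O : List Bool)
    (R : ℕ → ℕ) : Instr.shiftL.apply ⟨w.drop (i + 1), (w.take (i + 1)).reverse, O, R⟩ =
      ⟨w.drop i, (w.take i).reverse, O, R⟩ := by
  rw [List.take_succ_eq_append_getElem hi, List.reverse_append, List.drop_eq_getElem_cons hi]
  rfl

/-- Moving the head back to the beginning of the input. -/
theorem Runs.rewind {w : List Γ'} {x : ℕ} (hx : x ≤ w.length) (O : List Bool) (R : ℕ → ℕ) :
    Runs (.loop .aux (.instr .shiftL)) ⟨w.drop x, (w.take x).reverse, O, R⟩ ⟨w, [], O, R⟩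
      (x * 2 + 1) := by
  have := Runs.loop (T := .aux) (p := .instr .shiftL) (c := 1) x
    (fun i => ⟨w.drop (x - i), (w.take (x - i)).reverse, O, R⟩)
    (fun i hi => by
      have : w.take (x - i) ≠ [] := by
        rw [← List.length_pos_iff, List.length_take]
        omega
      simp [Test.eval, this])
    (by simp [Test.eval])
    (fun i hi => by
      obtain ⟨j, hj⟩ : ∃ j, x - i = j + 1 := ⟨x - i - 1, by omega⟩
      have hj' : x - (i + 1) = j := by omega
      simp only [hj, hj']
      exact Instr.apply_shiftL (w := w) (i := j) (by omega) O R ▸ Runs.instr .shiftL _)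
  simpa using this

/-! ### Bounded polynomial-time functions -/

/-- `PT F`: the function `F` of a word `w` and of `k` numbers that do not exceed the length of `w`
has values that do not exceed the length of `w`, and is computed in polynomial time by a while
program. The program can be placed anywhere: it finds the length of `w` in register `0` and the
arguments in the registers given by `ρ`, uses the registers from `b` on as its (empty) work space,
and leaves its result in register `b`, with all else unchanged. -/
structure PT {k : ℕ} (F : List Γ' → (Fin k → ℕ) → ℕ) : Prop where
  le : ∀ w v, w ≠ [] → (∀ i, v i ≤ w.length) → F w v ≤ w.length
  exists_prog : ∀ (ρ : Fin k → ℕ) (b : ℕ), 0 < b → (∀ i, ρ i < b) →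
    ∃ (p : Prog) (T : Polynomial ℕ), ∀ w R, w ≠ [] → R 0 = w.length →
      (∀ i, R (ρ i) ≤ w.length) → (∀ j, b ≤ j → R j = 0) →
        Runs p (mem w R) (mem w (Function.update R b (F w fun i => R (ρ i)))) (T.eval w.length)

namespace PT

variable {k : ℕ}

theorem congr {F G : List Γ' → (Fin k → ℕ) → ℕ} (hF : PT F)
    (h : ∀ w v, w ≠ [] → (∀ i, v i ≤ w.length) → F w v = G w v) : PT G where
  le w v hw hv := h w v hw hv ▸ hF.le w v hw hv
  exists_prog ρ b hb hρ := by
    obtain ⟨p, T, H⟩ := hF.exists_prog ρ b hb hρ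
    exact ⟨p, T, fun w R hw h0 hR hj => h w _ hw hR ▸ H w R hw h0 hR hj⟩

theorem var (i : Fin k) : PT fun _ v => v i where
  le _ _ _ hv := hv i
  exists_prog ρ b hb hρ := by
    refine ⟨.copy (ρ i) b (b + 1), 7 * Polynomial.X + 3, fun w R hw h0 hR hj => ?_⟩
    have := hρ i
    refine (Runs.copy (by omega) (by omega) (by omega) w [] [] R (hj b le_rfl)
      (hj (b + 1) (by omega))).mono ?_
    have := hR i
    simp
    omega

theorem length : PT fun (w : List Γ') (_ : Fin k → ℕ) => w.length where
  le _ _ _ _ := le_rfl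
  exists_prog ρ b hb hρ := by
    refine ⟨.copy 0 b (b + 1), 7 * Polynomial.X + 3, fun w R hw h0 hR hj => ?_⟩
    refine (h0 ▸ Runs.copy (x := 0) (by omega) (by omega) (by omega) w [] [] R (hj b le_rfl)
      (hj (b + 1) (by omega))).mono ?_
    simp
    omega

theorem one : PT fun (_ : List Γ') (_ : Fin k → ℕ) => 1 where
  le w _ hw _ := List.length_pos_iff.2 hw
  exists_prog ρ b hb hρ := by
    refine ⟨.instr (.inc b), 1, fun w R hw h0 hR hj => ?_⟩
    convert Runs.instr (.inc b) (mem w R) using 1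
    · simp [mem, Instr.apply, hj b le_rfl]
    · simp

theorem sub : PT fun _ (v : Fin 2 → ℕ) => v 0 - v 1 where
  le w v hw hv := (Nat.sub_le _ _).trans (hv 0)
  exists_prog ρ b hb hρ := by
    refine ⟨.seq (.copy (ρ 0) b (b + 1)) (.seq (.copy (ρ 1) (b + 1) (b + 2))
      (.loop (.reg (b + 1)) (.seq (.instr (.dec b)) (.instr (.dec (b + 1)))))),
      17 * Polynomial.X + 7, fun w R hw h0 hR hj => ?_⟩
    have h0' := hρ 0
    have h1' := hρ 1
    have hb0 := hj b le_rfl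
    have hb1 := hj (b + 1) (by omega)
    have hb2 := hj (b + 2) (by omega)
    have r1 := Runs.copy (x := ρ 0) (y := b) (z := b + 1) (by omega) (by omega) (by omega)
      w [] [] R hb0 hb1
    have r2 := Runs.copy (x := ρ 1) (y := b + 1) (z := b + 2) (by omega) (by omega) (by omega)
      w [] [] (Function.update R b (R (ρ 0))) (by simp [hb1]) (by simp [hb2])
    have r3 := Runs.loop (T := .reg (b + 1))
      (p := .seq (.instr (.dec b)) (.instr (.dec (b + 1)))) (c := 2) (R (ρ 1))
      (fun i => mem w (Function.update (Function.update R b (R (ρ 0) - i)) (b + 1) (R (ρ 1) - i)))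
      (fun i hi => by
        rw [Test.eval_reg_eq_true]
        simp
        omega)
      (by simp [Test.eval_reg_eq_false])
      (fun i hi => by
        convert (Runs.instr (.dec b) _).seq (Runs.instr (.dec (b + 1)) _) using 1
        simp only [Instr.apply]
        congr 1
        funext r
        simp only [Function.update_apply]
        split_ifs <;> omega)
    have e1 : Function.update R b (R (ρ 0)) (ρ 1) = R (ρ 1) := by
      simp [Function.update_of_ne h1'.ne]
    rw [e1] at r2
    have e2 : mem w (Function.update (Function.update R b (R (ρ 0) - R (ρ 1))) (b + 1)
        (R (ρ 1) - R (ρ 1))) = mem w (Function.update R b (R (ρ 0) - R (ρ 1))) := by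
      simp only [mem]
      congr 1
      funext r
      simp only [Function.update_apply]
      split_ifs <;> simp_all
    rw [e2] at r3
    refine (r1.seq (r2.seq r3)).mono ?_
    have := hR 0
    have := hR 1
    simp
    omega

theorem isSym (c : Γ') : PT fun w (v : Fin 1 → ℕ) => if w[v 0]? = some c then 1 else 0 where
  le w v hw hv := by
    have := List.length_pos_iff.2 hw
    split_ifs <;> omega
  exists_prog ρ b hb hρ := by
    refine ⟨.seq (.copy (ρ 0) b (b + 1)) (.seq
      (.loop (.reg b) (.seq (.instr (.dec b)) (.instr .shiftR))) (.seq
      (.ite (.sym c) (.instr (.inc b)) (.instr (.dec b))) (.loop .aux (.instr .shiftL)))),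
      12 * Polynomial.X + 7, fun w R hw h0 hR hj => ?_⟩
    have h0' := hρ 0
    have hx := hR 0
    have hb0 := hj b le_rfl
    have hb1 := hj (b + 1) (by omega)
    have r1 := Runs.copy (x := ρ 0) (y := b) (z := b + 1) (by omega) (by omega) (by omega)
      w [] [] R hb0 hb1
    change Runs _ _ (mem w (Function.update R b (if w[R (ρ 0)]? = some c then 1 else 0))) _
    generalize R (ρ 0) = x at *
    have r2 := Runs.loop (T := .reg b) (p := .seq (.instr (.dec b)) (.instr .shiftR)) (c := 2) x
      (fun i => ⟨w.drop i, (w.take i).reverse, [], Function.update R b (x - i)⟩)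
      (fun i hi => by
        rw [Test.eval_reg_eq_true]
        simp
        omega)
      (by simp [Test.eval_reg_eq_false])
      (fun i hi => by
        convert (Runs.instr (.dec b) _).seq (Runs.instr .shiftR _) using 1
        rw [Instr.apply, Instr.apply_shiftR (w := w) (i := i) (by omega)]
        simp [Nat.sub_sub])
    have r3 : Runs (.ite (.sym c) (.instr (.inc b)) (.instr (.dec b)))
        ⟨w.drop x, (w.take x).reverse, [], Function.update R b (x - x)⟩
        ⟨w.drop x, (w.take x).reverse, [],
          Function.update R b (if w[x]? = some c then 1 else 0)⟩ (1 + 1) := by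
      by_cases h : w[x]? = some c
      · refine Runs.ite_true (by simp [Test.eval, h]) ?_
        convert Runs.instr (.inc b) _ using 1
        simp [Instr.apply, h]
      · refine Runs.ite_false (by simp [Test.eval, h]) ?_
        convert Runs.instr (.dec b) _ using 1
        simp [Instr.apply, h]
    have r4 := Runs.rewind hx [] (Function.update R b (if w[x]? = some c then 1 else 0))
    refine (r1.seq (r2.seq (r3.seq r4))).mono ?_
    simp
    omega

/-- A value may be computed first and then be used as a further argument. -/
theorem bind {F : List Γ' → (Fin (k + 1) → ℕ) → ℕ} {G : List Γ' → (Fin k → ℕ) → ℕ} (hF : PT F)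
    (hG : PT G) : PT fun w v => F w (Fin.cons (G w v) v) where
  le w v hw hv := hF.le w _ hw (Fin.cases (hG.le w v hw hv) hv)
  exists_prog ρ b hb hρ := by
    obtain ⟨p, T, H⟩ := hG.exists_prog ρ b hb hρ
    obtain ⟨q, U, H'⟩ := hF.exists_prog (Fin.cons b ρ) (b + 1) (by omega)
      (Fin.cases (by simp) fun i => by
        have := hρ i
        simp
        omega)
    refine ⟨.seq p (.seq q (.move (b + 1) b)), T + U + 5 * Polynomial.X + 2,
      fun w R hw h0 hR hj => ?_⟩
    have r1 := H w R hw h0 hR hj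
    have hg := hG.le w _ hw hR
    generalize hgg : G w (fun i => R (ρ i)) = g at *
    have hv : (fun i => Function.update R b g ((Fin.cons b ρ : Fin (k + 1) → ℕ) i)) =
        (Fin.cons g fun i => R (ρ i) : Fin (k + 1) → ℕ) := by
      funext i
      cases i using Fin.cases with
      | zero => simp
      | succ i => simp [Function.update_of_ne (hρ i).ne]
    have hR' : ∀ i, Function.update R b g ((Fin.cons b ρ : Fin (k + 1) → ℕ) i) ≤ w.length := by
      intro i
      rw [congrFun hv i]
      cases i using Fin.cases with
      | zero => simpa using hg
      | succ i => simpa using hR i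
    have r2 := H' w (Function.update R b g) hw (by rw [Function.update_of_ne (by omega), h0]) hR'
      (fun j hj' => by rw [Function.update_of_ne (by omega), hj j (by omega)])
    have hf := hF.le w _ hw hR'
    rw [hv] at r2 hf
    generalize hff : F w (Fin.cons g fun i => R (ρ i)) = f at *
    have r3 := Runs.move (x := b + 1) (y := b) (by omega) w [] []
      (Function.update (Function.update R b g) (b + 1) f)
    have e : Function.update (Function.update (Function.update (Function.update R b g) (b + 1) f)
        (b + 1) 0) b (Function.update (Function.update R b g) (b + 1) f (b + 1)) =
        Function.update R b f := by
      funext r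
      have := hj (b + 1) (by omega)
      simp only [Function.update_apply]
      split_ifs <;> simp_all
    rw [e] at r3
    refine (r1.seq (r2.seq r3)).mono ?_
    simp
    omega

/-- The arguments may be renamed. -/
theorem rename {n : ℕ} {F : List Γ' → (Fin n → ℕ) → ℕ} (hF : PT F) (s : Fin n → Fin k) :
    PT fun w v => F w fun i => v (s i) where
  le w _ hw hv := hF.le w _ hw fun i => hv (s i)
  exists_prog ρ b hb hρ :=
    let ⟨p, T, H⟩ := hF.exists_prog (fun i => ρ (s i)) b hb fun i => hρ (s i)
    ⟨p, T, fun w R hw h0 hR hj => H w R hw h0 (fun i => hR (s i)) hj⟩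

/-- A choice between two functions. -/
theorem ifz {C F G : List Γ' → (Fin k → ℕ) → ℕ} (hC : PT C) (hF : PT F) (hG : PT G) :
    PT fun w v => if C w v = 0 then F w v else G w v where
  le w v hw hv := by
    split_ifs
    · exact hF.le w v hw hv
    · exact hG.le w v hw hv
  exists_prog ρ b hb hρ := by
    obtain ⟨p, T, H⟩ := hC.exists_prog ρ b hb hρ
    obtain ⟨q, U, H'⟩ := hF.exists_prog ρ b hb hρ
    obtain ⟨r, V, H''⟩ := hG.exists_prog ρ b hb hρ
    refine ⟨.seq p (.ite (.reg b) (.seq (.clear b) r) q), T + (2 * Polynomial.X + 1 + V + U) + 1,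
      fun w R hw h0 hR hj => ?_⟩
    have r1 := H w R hw h0 hR hj
    have hc := hC.le w _ hw hR
    generalize hcc : C w (fun i => R (ρ i)) = c at *
    have e : Function.update (Function.update R b c) b 0 = R := by
      rw [Function.update_idem, ← hj b le_rfl, Function.update_eq_self]
    by_cases h : c = 0
    · have e' : Function.update R b c = R := by
        rw [h, ← hj b le_rfl, Function.update_eq_self]
      rw [if_pos h]
      rw [e'] at r1
      have r2 := H' w R hw h0 hR hj
      refine (r1.seq (r2.ite_false (T := .reg b) (p := .seq (.clear b) r) ?_)).mono ?_
      · rw [Test.eval_reg_eq_false]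
        exact hj b le_rfl
      · simp
        omega
    · rw [if_neg h]
      have r2 := Runs.clear b w [] [] (Function.update R b c)
      simp only [Function.update_self, e] at r2
      have r3 := H'' w R hw h0 hR hj
      refine (r1.seq ((r2.seq r3).ite_true (T := .reg b) (q := q) ?_)).mono ?_
      · simp [Test.eval_reg_eq_true, h]
      · simp
        omega

/-- Recursion over the positions of the word. -/
theorem recLength {F : List Γ' → (Fin k → ℕ) → ℕ} {G : List Γ' → (Fin (k + 2) → ℕ) → ℕ}
    (hF : PT F) (hG : PT G) : PT fun w v =>
      Nat.rec (F w v) (fun t a => G w (Fin.cons t (Fin.cons a v))) w.length := by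
  have hle : ∀ w v, w ≠ [] → (∀ i, v i ≤ w.length) → ∀ n ≤ w.length,
      (Nat.rec (F w v) (fun t a => G w (Fin.cons t (Fin.cons a v))) n : ℕ) ≤ w.length := by
    intro w v hw hv n hn
    induction n with
    | zero => exact hF.le w v hw hv
    | succ n ih =>
      exact hG.le w _ hw (Fin.cases (by simpa using (by omega))
        (Fin.cases (by simpa using ih (by omega)) hv))
  refine ⟨fun w v hw hv => hle w v hw hv _ le_rfl, fun ρ b hb hρ => ?_⟩
  obtain ⟨p, T, H⟩ := hF.exists_prog ρ b hb hρ
  obtain ⟨q, U, H'⟩ := hG.exists_prog (Fin.cons (b + 1) (Fin.cons b ρ)) (b + 3) (by omega)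
    (Fin.cases (by simp) (Fin.cases (by simp) fun i => by
      have := hρ i
      simp
      omega))
  refine ⟨.seq p (.seq (.copy 0 (b + 2) (b + 3)) (.seq
    (.loop (.reg (b + 2)) (.seq q (.seq (.move (b + 3) b)
      (.seq (.instr (.inc (b + 1))) (.instr (.dec (b + 2)))))))
    (.clear (b + 1)))), T + (7 * Polynomial.X + 3) +
      (Polynomial.X * (U + (5 * Polynomial.X + 4) + 1) + 1) + (2 * Polynomial.X + 1),
    fun w R hw h0 hR hj => ?_⟩
  have r1 := H w R hw h0 hR hj
  have hA := hle w _ hw hR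
  generalize hL : w.length = L at *
  let A : ℕ → ℕ := fun n => Nat.rec (F w fun i => R (ρ i))
    (fun t a => G w (Fin.cons t (Fin.cons a fun i => R (ρ i)))) n
  have hA : ∀ n ≤ L, A n ≤ L := hA
  have hA0 : A 0 = F w fun i => R (ρ i) := rfl
  have hAs : ∀ n, A (n + 1) = G w (Fin.cons n (Fin.cons (A n) fun i => R (ρ i))) := fun n => rfl
  change Runs _ _ (mem w (Function.update R b (A L))) _
  rw [← hA0] at r1
  clear_value A
  have hb1 := hj (b + 1) (by omega)
  have hb2 := hj (b + 2) (by omega)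
  have hb3 := hj (b + 3) (by omega)
  have r2 := Runs.copy (x := 0) (y := b + 2) (z := b + 3) (by omega) (by omega) (by omega)
    w [] [] (Function.update R b (A 0)) (by simp [hb2]) (by simp [hb3])
  -- The registers after `i` rounds: the value, the number of rounds done, and of rounds to do.
  let Q : ℕ → ℕ → ℕ := fun i r => if r = b then A i else if r = b + 1 then i else
    if r = b + 2 then L - i else R r
  have r3 : Runs _ (mem w (Q 0)) (mem w (Q L)) _ := Runs.loop (T := .reg (b + 2))
    (p := .seq q (.seq (.move (b + 3) b) (.seq (.instr (.inc (b + 1))) (.instr (.dec (b + 2))))))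
    (c := U.eval L + (5 * L + 4)) L (fun i => mem w (Q i))
    (fun i hi => by
      rw [Test.eval_reg_eq_true]
      simp [Q]
      omega)
    (by simp [Test.eval_reg_eq_false, Q])
    (fun i hi => by
      have hv : (fun j => Q i ((Fin.cons (b + 1) (Fin.cons b ρ) : Fin (k + 2) → ℕ) j)) =
          (Fin.cons i (Fin.cons (A i) fun i => R (ρ i)) : Fin (k + 2) → ℕ) := by
        funext j
        cases j using Fin.cases with
        | zero => simp [Q]
        | succ j =>
          cases j using Fin.cases with
          | zero => simp [Q]
          | succ j =>
            have := hρ j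
            simp only [Fin.cons_succ, Q]
            rw [if_neg (by omega), if_neg (by omega), if_neg (by omega)]
      have hR' : ∀ j, Q i ((Fin.cons (b + 1) (Fin.cons b ρ) : Fin (k + 2) → ℕ) j) ≤ L := by
        intro j
        rw [congrFun hv j]
        cases j using Fin.cases with
        | zero =>
          simp
          omega
        | succ j =>
          cases j using Fin.cases with
          | zero => simpa using hA i (by omega)
          | succ j => simpa using hR j
      have s1 := H' w (Q i) hw
        (by
          simp only [Q]
          rw [if_neg (by omega), if_neg (by omega), if_neg (by omega), h0, hL])
        (fun j => (hR' j).trans hL.ge)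
        (fun j hj' => by
          simp only [Q]
          rw [if_neg (by omega), if_neg (by omega), if_neg (by omega), hj j (by omega)])
      rw [hv, ← hAs, hL] at s1
      have s2 := Runs.move (x := b + 3) (y := b) (by omega) w [] []
        (Function.update (Q i) (b + 3) (A (i + 1)))
      have s3 := s1.seq (s2.seq ((Runs.instr (.inc (b + 1)) _).seq (Runs.instr (.dec (b + 2)) _)))
      have e : (Instr.dec (b + 2)).apply ((Instr.inc (b + 1)).apply ⟨w, [], [],
          Function.update (Function.update (Function.update (Q i) (b + 3) (A (i + 1))) (b + 3) 0) b
            (Function.update (Q i) (b + 3) (A (i + 1)) (b + 3))⟩) = mem w (Q (i + 1)) := by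
        simp only [mem, Instr.apply]
        congr 1
        funext r
        simp only [Function.update_apply, Q]
        split_ifs <;> first | omega | simp_all
      rw [e] at s3
      refine s3.mono ?_
      have h1 := hA i (by omega)
      have h2 := hA (i + 1) (by omega)
      simp [Q]
      omega)
  have r4 := Runs.clear (b + 1) w [] [] (Q L)
  have e1 : Function.update (Function.update R b (A 0)) (b + 2) (Function.update R b (A 0) 0) =
      Q 0 := by
    funext r
    have : Function.update R b (A 0) 0 = L := by rw [Function.update_of_ne (by omega), h0]
    simp only [this, Function.update_apply, Q]
    split_ifs <;> first | omega | simp_all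
  have e2 : Function.update (Q L) (b + 1) 0 = Function.update R b (A L) := by
    funext r
    simp only [Function.update_apply, Q]
    split_ifs <;> first | omega | simp_all
  rw [e1] at r2
  rw [e2] at r4
  refine (r1.seq (r2.seq (r3.seq r4))).mono ?_
  have e3 : Function.update R b (A 0) 0 = L := by
    rw [Function.update_of_ne (by omega), h0]
  have e4 : Q L (b + 1) = L := by
    simp [Q]
  rw [e3, e4]
  simp
  nlinarith

end PT

/-- A bounded polynomial-time function without further arguments yields a decision procedure. -/
theorem PT.polyTimeDecidable {α : Type} {enc : α → List Γ'} {P : α → Prop}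
    {F : List Γ' → (Fin 0 → ℕ) → ℕ} (hF : PT F) (henc : ∀ a, enc a ≠ [])
    (h : ∀ a, F (enc a) Fin.elim0 ≠ 0 ↔ P a) : PolyTimeDecidable enc P := by
  obtain ⟨p, T, H⟩ := hF.exists_prog Fin.elim0 1 one_pos fun i => i.elim0
  refine polyTimeDecidable_of_prog enc P (fun a => F (enc a) Fin.elim0 != 0)
    (fun a => by simp [← h a]) (.seq (.loop .inp (.seq (.instr .shiftR) (.instr (.inc 0)))) (.seq
      (.loop .aux (.instr .shiftL)) (.seq p (.seq
      (.ite (.reg 1) (.seq (.clear 1) (.instr (.emit true))) (.instr (.emit false))) (.seq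
      (.clear 0) (.loop .inp (.instr .erase))))))) (T + 11 * Polynomial.X + 7) fun a => ?_
  generalize hw : enc a = w
  have hne : w ≠ [] := hw ▸ henc a
  have r1 := Runs.loop (T := .inp) (p := .seq (.instr .shiftR) (.instr (.inc 0))) (c := 2) w.length
    (fun i => ⟨w.drop i, (w.take i).reverse, [], Function.update (fun _ => 0) 0 i⟩)
    (fun i hi => by simp [Test.eval, hi]) (by simp [Test.eval])
    (fun i hi => by
      convert (Runs.instr .shiftR _).seq (Runs.instr (.inc 0) _) using 1
      rw [Instr.apply_shiftR hi]
      simp [Instr.apply])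
  have r2 := Runs.rewind (w := w) le_rfl [] (Function.update (fun _ => 0) 0 w.length)
  have r3 := H w (Function.update (fun _ => 0) 0 w.length) hne (by simp) (fun i => i.elim0)
    (fun j hj => by rw [Function.update_of_ne (by omega)])
  have hle := hF.le w Fin.elim0 hne (fun i => i.elim0)
  have hv : (fun i : Fin 0 => Function.update (fun _ => 0) 0 w.length (Fin.elim0 i : ℕ)) =
      Fin.elim0 := Subsingleton.elim _ _
  rw [hv] at r3
  generalize F w Fin.elim0 = f at *
  have r4 : Runs (.ite (.reg 1) (.seq (.clear 1) (.instr (.emit true))) (.instr (.emit false)))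
      (mem w (Function.update (Function.update (fun _ => 0) 0 w.length) 1 f))
      ⟨w, [], [f != 0], Function.update (fun _ => 0) 0 w.length⟩ (f * 2 + 1 + 1 + 1) := by
    by_cases hf : f = 0
    · refine Runs.mono (n := 1 + 1) (Runs.ite_false (by simp [Test.eval_reg_eq_false, hf]) ?_)
        (by omega)
      convert Runs.instr (.emit false) _ using 1
      simp only [Instr.apply, hf]
      congr 1
      funext r
      simp only [Function.update_apply]
      split_ifs <;> simp_all
    · refine Runs.ite_true (by simp [Test.eval_reg_eq_true, hf]) ?_
      convert (Runs.clear 1 _ _ _ _).seq (Runs.instr (.emit true) _) using 1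
      · simp only [Instr.apply]
        congr 1
        · simp [hf]
        · funext r
          simp only [Function.update_apply]
          split_ifs <;> simp_all
      · simp
  have r5 := Runs.clear 0 w [] [f != 0] (Function.update (fun _ => 0) 0 w.length)
  have r6 := Runs.loop (T := .inp) (p := .instr .erase) (c := 1) w.length
    (fun i => ⟨w.drop i, [], [f != 0], fun _ => 0⟩)
    (fun i hi => by simp [Test.eval, hi]) (by simp [Test.eval])
    (fun i hi => by
      convert Runs.instr .erase _ using 1
      simp [Instr.apply])
  have e0 : Function.update (fun _ : ℕ => 0) 0 0 = fun _ : ℕ => 0 := Function.update_eq_self 0 _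
  simp only [List.drop_zero, List.take_zero, List.reverse_nil, e0, List.drop_length,
    List.take_length] at r1
  simp only [List.drop_length, List.take_length] at r2
  simp only [Function.update_idem, Function.update_self, e0] at r5
  simp only [List.drop_zero, List.drop_length] at r6
  refine (r1.seq (r2.seq (r3.seq (r4.seq (r5.seq r6))))).mono ?_
  simp
  omega

/-! ### Closure properties of bounded polynomial-time functions -/

open Classical in
/-- `PTP P`: the predicate `P` of a word `w` and of `k` numbers that do not exceed its length is
decidable in polynomial time. -/
def PTP {k : ℕ} (P : List Γ' → (Fin k → ℕ) → Prop) : Prop :=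
  PT fun w v => if P w v then 1 else 0

/-- Addition, truncated at the length of the word `w`. -/
def cadd (w : List Γ') (a b : ℕ) : ℕ :=
  min (a + b) w.length

section Closure

variable {k : ℕ}

theorem PT.comp₁ {f : List Γ' → ℕ → ℕ} {g : List Γ' → (Fin k → ℕ) → ℕ}
    (hf : PT fun w (v : Fin 1 → ℕ) => f w (v 0)) (hg : PT g) : PT fun w v => f w (g w v) :=
  (hf.rename fun _ => (0 : Fin (k + 1))).bind hg

theorem PT.comp₂ {f : List Γ' → ℕ → ℕ → ℕ} {g h : List Γ' → (Fin k → ℕ) → ℕ}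
    (hf : PT fun w (v : Fin 2 → ℕ) => f w (v 0) (v 1)) (hg : PT g) (hh : PT h) :
    PT fun w v => f w (g w v) (h w v) :=
  ((hf.rename ![(0 : Fin (k + 2)), 1]).bind (hg.rename Fin.succ)).bind hh

theorem PT.comp₃ {f : List Γ' → ℕ → ℕ → ℕ → ℕ} {g h i : List Γ' → (Fin k → ℕ) → ℕ}
    (hf : PT fun w (v : Fin 3 → ℕ) => f w (v 0) (v 1) (v 2)) (hg : PT g) (hh : PT h) (hi : PT i) :
    PT fun w v => f w (g w v) (h w v) (i w v) :=
  (((hf.rename ![(0 : Fin (k + 3)), 1, 2]).bind (hg.rename fun j => j.succ.succ)).bind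
    (hh.rename Fin.succ)).bind hi

theorem PT.comp₄ {f : List Γ' → ℕ → ℕ → ℕ → ℕ → ℕ} {g h i j : List Γ' → (Fin k → ℕ) → ℕ}
    (hf : PT fun w (v : Fin 4 → ℕ) => f w (v 0) (v 1) (v 2) (v 3)) (hg : PT g) (hh : PT h)
    (hi : PT i) (hj : PT j) : PT fun w v => f w (g w v) (h w v) (i w v) (j w v) :=
  ((((hf.rename ![(0 : Fin (k + 4)), 1, 2, 3]).bind (hg.rename fun j => j.succ.succ.succ)).bind
    (hh.rename fun j => j.succ.succ)).bind (hi.rename Fin.succ)).bind hj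

variable {P Q : List Γ' → (Fin k → ℕ) → Prop} {f g h : List Γ' → (Fin k → ℕ) → ℕ}

theorem PT.tsub (hf : PT f) (hg : PT g) : PT fun w v => f w v - g w v :=
  PT.comp₂ (f := fun _ a b => a - b) PT.sub hf hg

theorem PT.zero : PT fun (_ : List Γ') (_ : Fin k → ℕ) => 0 :=
  PT.one.tsub PT.one

theorem PT.add (hf : PT f) (hg : PT g) : PT fun w v => cadd w (f w v) (g w v) := by
  -- `min (a + b) L = L - (L - a - b)`, as `a` does not exceed `L`
  refine (PT.length.tsub ((PT.length.tsub hf).tsub hg)).congr fun w v hw hv => ?_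
  have := hf.le w v hw hv
  have := hg.le w v hw hv
  simp only [cadd]
  omega

theorem PTP.congr (hP : PTP P) (H : ∀ w v, w ≠ [] → (∀ i, v i ≤ w.length) → (P w v ↔ Q w v)) :
    PTP Q := by
  classical
  exact PT.congr hP fun w v hw hv => if_congr (H w v hw hv) rfl rfl

theorem PT.ite (hP : PTP P) (hf : PT f) (hg : PT g) [∀ w v, Decidable (P w v)] :
    PT fun w v => if P w v then f w v else g w v := by
  refine (PT.ifz hP hg hf).congr fun w v _ _ => ?_
  by_cases h : P w v <;> simp [h]

theorem PTP.not (hP : PTP P) : PTP fun w v => ¬ P w v := by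
  classical
  refine (PT.ite hP PT.zero PT.one).congr fun w v _ _ => ?_
  by_cases h : P w v <;> simp [h]

theorem PTP.and (hP : PTP P) (hQ : PTP Q) : PTP fun w v => P w v ∧ Q w v := by
  classical
  refine (PT.ite hP hQ PT.zero).congr fun w v _ _ => ?_
  by_cases h : P w v <;> simp [h]

theorem PTP.or (hP : PTP P) (hQ : PTP Q) : PTP fun w v => P w v ∨ Q w v := by
  classical
  refine (PT.ite hP PT.one hQ).congr fun w v _ _ => ?_
  by_cases h : P w v <;> simp [h]

theorem PTP.imp (hP : PTP P) (hQ : PTP Q) : PTP fun w v => P w v → Q w v := by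
  classical
  refine (PT.ite hP hQ PT.one).congr fun w v _ _ => ?_
  by_cases h : P w v <;> simp [h]

theorem PTP.const (p : Prop) : PTP fun (_ : List Γ') (_ : Fin k → ℕ) => p := by
  by_cases h : p
  · exact PT.one.congr fun _ _ _ _ => by simp [h]
  · exact PT.zero.congr fun _ _ _ _ => by simp [h]

theorem PTP.lt (hf : PT f) (hg : PT g) : PTP fun w v => f w v < g w v := by
  refine (PT.ifz (hg.tsub hf) PT.zero PT.one).congr fun w v _ _ => ?_
  by_cases h : f w v < g w v
  · simp [h]
    omega
  · simp [h]
    omega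

theorem PTP.le (hf : PT f) (hg : PT g) : PTP fun w v => f w v ≤ g w v :=
  (PTP.lt hg hf).not.congr fun _ _ _ _ => not_lt

theorem PTP.eq (hf : PT f) (hg : PT g) : PTP fun w v => f w v = g w v :=
  ((PTP.le hf hg).and (PTP.le hg hf)).congr fun _ _ _ _ => le_antisymm_iff.symm

theorem PTP.sym (hf : PT f) (c : Γ') : PTP fun w v => w[f w v]? = some c :=
  (PT.comp₁ (f := fun w a => if w[a]? = some c then 1 else 0) (PT.isSym c) hf).congr
    fun w v _ _ => by congr

theorem PTP.comp₂ {P : List Γ' → ℕ → ℕ → Prop}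
    (hP : PTP fun w (v : Fin 2 → ℕ) => P w (v 0) (v 1)) (hf : PT f) (hg : PT g) :
    PTP fun w v => P w (f w v) (g w v) :=
  PT.comp₂ (f := fun w a b => open Classical in if P w a b then 1 else 0) hP hf hg

theorem PTP.comp₃ {P : List Γ' → ℕ → ℕ → ℕ → Prop}
    (hP : PTP fun w (v : Fin 3 → ℕ) => P w (v 0) (v 1) (v 2)) (hf : PT f) (hg : PT g) (hh : PT h) :
    PTP fun w v => P w (f w v) (g w v) (h w v) :=
  PT.comp₃ (f := fun w a b c => open Classical in if P w a b c then 1 else 0) hP hf hg hh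

theorem PTP.comp₄ {P : List Γ' → ℕ → ℕ → ℕ → ℕ → Prop} {i : List Γ' → (Fin k → ℕ) → ℕ}
    (hP : PTP fun w (v : Fin 4 → ℕ) => P w (v 0) (v 1) (v 2) (v 3)) (hf : PT f) (hg : PT g)
    (hh : PT h) (hi : PT i) : PTP fun w v => P w (f w v) (g w v) (h w v) (i w v) :=
  PT.comp₄ (f := fun w a b c d => open Classical in if P w a b c d then 1 else 0) hP hf hg hh hi

/-- Recursion with a number of rounds that is itself a bounded polynomial-time function. -/
theorem PT.natRec {G : List Γ' → ℕ → ℕ → (Fin k → ℕ) → ℕ} (hf : PT f) (hg : PT g)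
    (hG : PT fun w (v : Fin (k + 2) → ℕ) => G w (v 0) (v 1) fun i => v i.succ.succ) :
    PT fun w v => Nat.rec (f w v) (fun t a => G w t a v) (g w v) := by
  have hG' : PT fun w (v : Fin (k + 2) → ℕ) =>
      if v 0 < g w (fun i => v i.succ.succ) then G w (v 0) (v 1) (fun i => v i.succ.succ)
      else v 1 :=
    PT.ite (PTP.lt (PT.var 0) (hg.rename fun i => i.succ.succ)) hG (PT.var 1)
  refine (hf.recLength hG').congr fun w v hw hv => ?_
  have hle := hg.le w v hw hv
  have H : ∀ n, (Nat.rec (f w v) (fun t a => if t < g w v then G w t a v else a) n : ℕ) =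
      Nat.rec (f w v) (fun t a => G w t a v) (min n (g w v)) := by
    intro n
    induction n with
    | zero => simp
    | succ n ih =>
      by_cases hn : n < g w v
      · rw [Nat.min_eq_left (by omega)] at ih ⊢
        simp only [hn, if_true, ih]
      · rw [Nat.min_eq_right (by omega)] at ih ⊢
        simp only [hn, if_false, ih]
  have := H w.length
  rw [Nat.min_eq_right hle] at this
  exact this

open Classical in
theorem PTP.exists_lt {P : List Γ' → ℕ → (Fin k → ℕ) → Prop} (hf : PT f)
    (hP : PTP fun w (v : Fin (k + 1) → ℕ) => P w (v 0) fun i => v i.succ) :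
    PTP fun w v => ∃ t < f w v, P w t v := by
  have hG : PT fun w (v : Fin (k + 2) → ℕ) =>
      if P w (v 0) (fun i => v i.succ.succ) then 1 else v 1 :=
    PT.ite (P := fun w v => P w (v 0) fun i => v i.succ.succ)
      (PT.rename hP (Fin.cons 0 fun i => i.succ.succ)) PT.one (PT.var 1)
  refine (PT.natRec PT.zero hf (G := fun w t a v => if P w t v then 1 else a)
    hG).congr fun w v _ _ => ?_
  have H : ∀ n, (Nat.rec 0 (fun t a => if P w t v then 1 else a) n : ℕ) =
      if ∃ t < n, P w t v then 1 else 0 := by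
    intro n
    induction n with
    | zero => simp
    | succ n ih =>
      simp only [ih]
      by_cases h : P w n v
      · rw [if_pos h, if_pos ⟨n, n.lt_succ_self, h⟩]
      · rw [if_neg h]
        refine if_congr ⟨fun ⟨t, ht, h'⟩ => ⟨t, by omega, h'⟩, fun ⟨t, ht, h'⟩ => ⟨t, ?_, h'⟩⟩
          rfl rfl
        have : t ≠ n := fun e => h (e ▸ h')
        omega
  exact (H _).trans (by congr)

theorem PTP.forall_lt {P : List Γ' → ℕ → (Fin k → ℕ) → Prop} (hf : PT f)
    (hP : PTP fun w (v : Fin (k + 1) → ℕ) => P w (v 0) fun i => v i.succ) :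
    PTP fun w v => ∀ t < f w v, P w t v :=
  (PTP.exists_lt (P := fun w t v => ¬ P w t v) hf hP.not).not.congr fun w v _ _ => by
    push Not
    rfl

theorem PT.findGreatest {P : List Γ' → ℕ → (Fin k → ℕ) → Prop}
    [∀ w v, DecidablePred fun t => P w t v]
    (hP : PTP fun w (v : Fin (k + 1) → ℕ) => P w (v 0) fun i => v i.succ) :
    PT fun w v => Nat.findGreatest (fun t => P w t v) w.length := by
  have h1 : PT fun w (v : Fin (k + 2) → ℕ) => cadd w (v 0) 1 := (PT.var 0).add PT.one
  classical
  have hG : PT fun w (v : Fin (k + 2) → ℕ) =>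
      if P w (cadd w (v 0) 1) (fun i => v i.succ.succ) then cadd w (v 0) 1 else v 1 :=
    PT.ite (P := fun w v => P w (cadd w (v 0) 1) fun i => v i.succ.succ)
      (PT.bind (PT.rename hP (Fin.cons 0 fun i => i.succ.succ.succ)) h1) h1 (PT.var 1)
  refine (PT.natRec PT.zero PT.length
    (G := fun w t a v => if P w (cadd w t 1) v then cadd w t 1 else a) hG).congr fun w v _ _ => ?_
  have H : ∀ n ≤ w.length, (Nat.rec 0
      (fun t a => if P w (cadd w t 1) v then cadd w t 1 else a) n : ℕ) =
      Nat.findGreatest (fun t => P w t v) n := by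
    intro n hn
    induction n with
    | zero => simp
    | succ n ih =>
      have e : cadd w n 1 = n + 1 := Nat.min_eq_left hn
      simp only [ih (by omega), e, Nat.findGreatest_succ]
  exact H _ le_rfl

end Closure

/-! ### Reading the description of a transition system -/

/-- The symbol at the position `i` is a bit. -/
def IsBitAt (w : List Γ') (i : ℕ) : Prop :=
  w[i]? = some (.bit true) ∨ w[i]? = some (.bit false)

/-- The number of occurrences of the symbol `c` before the position `i`. -/
def countBefore (c : Γ') (w : List Γ') (i : ℕ) : ℕ :=
  (w.take i).count c

/-- The number whose binary digits, the least significant one first, are at the beginning of a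
word. All intermediate results are truncated at `L`, so that the computation is bounded. -/
def bitsVal (L : ℕ) : List Γ' → ℕ
  | .bit b :: l => min (min (bitsVal L l + bitsVal L l) L + b.toNat) L
  | _ => 0

open Classical in
/-- The position of the first digit of the `t`-th number of a list of numbers in binary, counted
through all blocks from `0` on: the last position that has `t` commas before it and does not follow a
digit. Position `0`, where `i - 1` is truncated, holds a bracket. -/
noncomputable def fieldStart (w : List Γ') (t : ℕ) : ℕ :=
  Nat.findGreatest (fun i => countBefore .comma w i = t ∧ ¬ IsBitAt w (i - 1)) w.length

/-- The `t`-th number of a list of numbers in binary. -/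
noncomputable def field (w : List Γ') (t : ℕ) : ℕ :=
  bitsVal w.length (w.drop (fieldStart w t))

open Classical in
/-- The number of numbers in the blocks up to the `r`-th one, where the first block has `r = 0`: the
number of commas before the bracket that closes the block. -/
noncomputable def blockEnd (w : List Γ') (r : ℕ) : ℕ :=
  countBefore .comma w (Nat.findGreatest
    (fun i => w[i]? = some .ket ∧ countBefore .ket w i = r) w.length)

section Polynomial

variable {k : ℕ} {f : List Γ' → (Fin k → ℕ) → ℕ}

theorem PTP.isBitAt (hf : PT f) : PTP fun w v => IsBitAt w (f w v) :=
  (PTP.sym hf _).or (PTP.sym hf _)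

theorem PT.countBefore (c : Γ') (hf : PT f) : PT fun w v => countBefore c w (f w v) := by
  refine PT.comp₁ (f := BoolNet.countBefore c) ?_ hf
  have hG : PT fun w (v : Fin 3 → ℕ) => if w[v 0]? = some c then cadd w (v 1) 1 else v 1 :=
    PT.ite (PTP.sym (PT.var 0) c) ((PT.var 1).add PT.one) (PT.var 1)
  refine (PT.natRec PT.zero (PT.var (0 : Fin 1))
    (G := fun w t a _ => if w[t]? = some c then cadd w a 1 else a) hG).congr fun w v _ hv => ?_
  have H : ∀ n ≤ w.length, (Nat.rec 0
      (fun t a => if w[t]? = some c then cadd w a 1 else a) n : ℕ) =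
      BoolNet.countBefore c w n := by
    intro n hn
    induction n with
    | zero => simp [BoolNet.countBefore]
    | succ n ih =>
      have hlen : BoolNet.countBefore c w n ≤ n :=
        List.count_le_length.trans (List.length_take_le _ _)
      have hs : BoolNet.countBefore c w (n + 1) =
          if w[n]? = some c then BoolNet.countBefore c w n + 1 else BoolNet.countBefore c w n := by
        rw [BoolNet.countBefore, List.take_succ_eq_append_getElem hn, List.count_append,
          List.getElem?_eq_getElem hn, List.count_singleton]
        by_cases h : w[n] = c <;> simp [h, BoolNet.countBefore]
      have hc : cadd w (BoolNet.countBefore c w n) 1 = BoolNet.countBefore c w n + 1 :=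
        Nat.min_eq_left (by omega)
      simp only [ih (by omega), hs, hc]
  exact H _ (hv 0)

/-- The digits are read from the end of the word on. -/
theorem PT.bitsVal_drop (hf : PT f) : PT fun w v => bitsVal w.length (w.drop (f w v)) := by
  refine PT.comp₁ (f := fun w i => bitsVal w.length (w.drop i)) ?_ hf
  have hi : PT fun w (v : Fin 3 → ℕ) => w.length - 1 - v 0 :=
    (PT.length.tsub PT.one).tsub (PT.var 0)
  have hd : PT fun w (v : Fin 3 → ℕ) => cadd w (v 1) (v 1) := (PT.var 1).add (PT.var 1)
  have hG : PT fun w (v : Fin 3 → ℕ) =>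
      if w[w.length - 1 - v 0]? = some (.bit true) then cadd w (cadd w (v 1) (v 1)) 1
      else if w[w.length - 1 - v 0]? = some (.bit false) then cadd w (cadd w (v 1) (v 1)) 0
      else 0 :=
    PT.ite (PTP.sym hi _) (hd.add PT.one) (PT.ite (PTP.sym hi _) (hd.add PT.zero) PT.zero)
  refine (PT.natRec PT.zero (PT.length.tsub (PT.var (0 : Fin 1)))
    (G := fun w t a _ =>
      if w[w.length - 1 - t]? = some (.bit true) then cadd w (cadd w a a) 1
      else if w[w.length - 1 - t]? = some (.bit false) then cadd w (cadd w a a) 0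
      else 0) hG).congr fun w v _ hv => ?_
  have H : ∀ n ≤ w.length, (Nat.rec 0 (fun t a =>
      if w[w.length - 1 - t]? = some (.bit true) then cadd w (cadd w a a) 1
      else if w[w.length - 1 - t]? = some (.bit false) then cadd w (cadd w a a) 0
      else 0) n : ℕ) = bitsVal w.length (w.drop (w.length - n)) := by
    intro n hn
    induction n with
    | zero => simp [bitsVal]
    | succ n ih =>
      have hlt : w.length - (n + 1) < w.length := by omega
      have e1 : w.length - 1 - n = w.length - (n + 1) := by omega
      have e2 : w.length - (n + 1) + 1 = w.length - n := by omega
      rw [List.drop_eq_getElem_cons hlt, e2]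
      simp only [ih (by omega), e1, List.getElem?_eq_getElem hlt, Option.some.injEq]
      generalize w[w.length - (n + 1)] = c
      match c with
      | .bit true => rfl
      | .bit false => rfl
      | .blank => rfl
      | .bra => rfl
      | .ket => rfl
      | .comma => rfl
  have := hv 0
  have e : w.length - (w.length - v 0) = v 0 := by omega
  exact (H _ (by omega)).trans (by rw [e])

theorem PT.fieldStart (hf : PT f) : PT fun w v => fieldStart w (f w v) := by
  refine PT.comp₁ (f := BoolNet.fieldStart) ?_ hf
  classical
  exact PT.findGreatest (P := fun w i v =>
    BoolNet.countBefore .comma w i = v 0 ∧ ¬ IsBitAt w (i - 1))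
    ((PTP.eq ((PT.var 0).countBefore _) (PT.var (Fin.succ 0))).and
      (PTP.isBitAt ((PT.var 0).tsub PT.one)).not)

theorem PT.field (hf : PT f) : PT fun w v => field w (f w v) :=
  hf.fieldStart.bitsVal_drop

theorem PT.blockEnd (hf : PT f) : PT fun w v => blockEnd w (f w v) := by
  refine PT.comp₁ (f := BoolNet.blockEnd) ?_ hf
  exact PT.countBefore _ (PT.findGreatest (P := fun w i v =>
    w[i]? = some .ket ∧ BoolNet.countBefore .ket w i = v 0)
    ((PTP.sym (PT.var 0) _).and (PTP.eq ((PT.var 0).countBefore _) (PT.var (Fin.succ 0)))))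

end Polynomial

/-- A number in binary. -/
abbrev bin (n : ℕ) : List Γ' :=
  encodingNatΓ'.encode n

theorem encodeNat_bit (b : Bool) (n : ℕ) (h : Nat.bit b n ≠ 0) :
    encodeNat (Nat.bit b n) = b :: encodeNat n := by
  have e : ∀ n : ℕ, encodeNat n = encodeNum (Num.ofNat' n) := fun n => by
    rw [Num.ofNat'_eq]
    rfl
  have hn : b = false → Num.ofNat' n ≠ 0 := by
    rintro rfl h0
    rw [Num.ofNat'_eq, ← Nat.cast_zero, Num.of_nat_inj] at h0
    exact h (by simp [h0])
  rw [e, e, Num.ofNat'_bit]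
  generalize Num.ofNat' n = x at *
  cases b <;> cases x
  · exact absurd rfl (hn rfl)
  all_goals rfl

theorem bin_eq_map (n : ℕ) : bin n = (encodeNat n).map Γ'.bit := by
  refine List.map_congr_left fun b _ => ?_
  cases b <;> rfl

theorem bitsVal_bin {L n : ℕ} (hn : n ≤ L) (l : List Γ') :
    bitsVal L (bin n ++ .comma :: l) = n := by
  rw [bin_eq_map]
  induction n using Nat.binaryRec with
  | zero => rfl
  | bit b n ih =>
    by_cases h : Nat.bit b n = 0
    · rw [h]
      rfl
    · rw [encodeNat_bit b n h, List.map_cons, List.cons_append, bitsVal, ih]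
      · rw [Nat.bit_val] at *
        omega
      · rw [Nat.bit_val] at hn
        omega

theorem isBit_of_mem_bin {n : ℕ} {c : Γ'} (h : c ∈ bin n) : c = .bit true ∨ c = .bit false := by
  rw [bin_eq_map, List.mem_map] at h
  obtain ⟨b, -, rfl⟩ := h
  cases b <;> simp

namespace FinTS

/-- The words that consist of several blocks of numbers. -/
def encodeBlocks (ls : List (List ℕ)) : List Γ' :=
  ls.flatMap encodeBlock

/-- The numbers of a block. -/
def body (l : List ℕ) : List Γ' :=
  l.flatMap fun k => bin k ++ [.comma]

theorem encodeBlock_eq (l : List ℕ) : encodeBlock l = .bra :: (body l ++ [.ket]) :=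
  rfl

theorem count_bin {n : ℕ} {c : Γ'} (h : c = .comma ∨ c = .ket) : (bin n).count c = 0 := by
  rw [List.count_eq_zero]
  intro hc
  rcases isBit_of_mem_bin hc with rfl | rfl <;> simp at h

theorem count_comma_body (l : List ℕ) : (body l).count .comma = l.length := by
  induction l with
  | nil => rfl
  | cons k l ih =>
    rw [body, List.flatMap_cons, List.count_append, List.count_append, count_bin (.inl rfl),
      ← body, ih]
    simp
    omega

theorem count_ket_body (l : List ℕ) : (body l).count .ket = 0 := by
  induction l with
  | nil => rfl
  | cons k l ih =>
    rw [body, List.flatMap_cons, List.count_append, List.count_append, count_bin (.inr rfl),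
      ← body, ih]
    simp

theorem count_comma_encodeBlocks (ls : List (List ℕ)) :
    (encodeBlocks ls).count .comma = ls.flatten.length := by
  induction ls with
  | nil => rfl
  | cons l ls ih =>
    rw [encodeBlocks, List.flatMap_cons, List.count_append, ← encodeBlocks, ih, encodeBlock_eq,
      List.count_cons, List.count_append, count_comma_body]
    simp

theorem count_ket_encodeBlocks (ls : List (List ℕ)) :
    (encodeBlocks ls).count .ket = ls.length := by
  induction ls with
  | nil => rfl
  | cons l ls ih =>
    rw [encodeBlocks, List.flatMap_cons, List.count_append, ← encodeBlocks, ih, encodeBlock_eq,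
      List.count_cons, List.count_append, count_ket_body]
    simp
    omega

end FinTS

theorem findGreatest_eq_length_left {w A : List Γ'} {P : ℕ → Prop} [DecidablePred P]
    (hA : A.length ≤ w.length)
    (h : P A.length) (h' : ∀ i, A.length < i → i ≤ w.length → ¬ P i) :
    Nat.findGreatest P w.length = A.length := by
  rw [Nat.findGreatest_eq_iff]
  exact ⟨hA, fun _ => h, fun i hi hi' => h' i hi hi'⟩

theorem countBefore_lt {A B : List Γ'} {c : Γ'} {i : ℕ} (hi : A.length < i) :
    A.count c < countBefore c (A ++ c :: B) i := by
  have : A ++ [c] <+: (A ++ c :: B).take i := by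
    rw [List.prefix_take_iff]
    simp
    omega
  have := this.sublist.count_le c
  rw [List.count_append, List.count_singleton_self] at this
  exact this

/-- The contents of the number field after the word `A`. -/
theorem field_eq {A B : List Γ'} {k : ℕ} {c : Γ'} (hc : ¬ (c = .bit true ∨ c = .bit false))
    (hk : k ≤ (A ++ [c] ++ bin k ++ .comma :: B).length) :
    field (A ++ [c] ++ bin k ++ .comma :: B) ((A ++ [c]).count .comma) = k := by
  have hs : fieldStart (A ++ [c] ++ bin k ++ .comma :: B) ((A ++ [c]).count .comma) =
      (A ++ [c]).length := by
    have hlast : (A ++ [c] ++ bin k ++ .comma :: B)[(A ++ [c]).length - 1]? = some c := by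
      simp
    classical
    refine findGreatest_eq_length_left (by simp) ⟨?_, ?_⟩ ?_
    · rw [countBefore, List.append_assoc, List.take_left]
    · rw [IsBitAt, hlast, Option.some.injEq, Option.some.injEq]
      exact hc
    · intro i hi hi' ⟨h1, h2⟩
      by_cases hik : i ≤ (A ++ [c] ++ bin k).length
      · obtain ⟨j, rfl⟩ : ∃ j, i = (A ++ [c]).length + j + 1 :=
          ⟨i - (A ++ [c]).length - 1, by omega⟩
        have hj : j < (bin k).length := by
          rw [List.length_append (as := A ++ [c])] at hik
          omega
        refine h2 ?_
        have : (A ++ [c] ++ bin k ++ .comma :: B)[(A ++ [c]).length + j + 1 - 1]? =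
            some (bin k)[j] := by
          rw [Nat.add_sub_cancel, List.append_assoc, List.getElem?_append_right (by omega),
            List.getElem?_append_left (by omega), List.getElem?_eq_getElem (by omega)]
          simp
        rw [IsBitAt, this, Option.some.injEq, Option.some.injEq]
        exact isBit_of_mem_bin (List.getElem_mem hj)
      · have := countBefore_lt (A := A ++ [c] ++ bin k) (B := B) (c := .comma) (i := i) (by omega)
        rw [h1, List.count_append, FinTS.count_bin (.inl rfl)] at this
        omega
  rw [field, hs]
  generalize (A ++ [c] ++ bin k ++ .comma :: B).length = L at *
  rw [List.append_assoc, List.drop_left, bitsVal_bin hk]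

open FinTS in
/-- The bound on the number ensures that it is not truncated. -/
theorem field_encodeBlocks (ls₁ ls₂ : List (List ℕ)) (l₁ l₂ : List ℕ) (k : ℕ)
    (hk : k ≤ (encodeBlocks (ls₁ ++ (l₁ ++ k :: l₂) :: ls₂)).length) :
    field (encodeBlocks (ls₁ ++ (l₁ ++ k :: l₂) :: ls₂)) (ls₁.flatten.length + l₁.length) = k := by
  have hw : encodeBlocks (ls₁ ++ (l₁ ++ k :: l₂) :: ls₂) =
      encodeBlocks ls₁ ++ .bra :: body l₁ ++ bin k ++
        .comma :: (body l₂ ++ [.ket] ++ encodeBlocks ls₂) := by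
    simp [encodeBlocks, encodeBlock_eq, body]
  obtain ⟨A, c, hc, hA⟩ : ∃ A c, ¬ (c = Γ'.bit true ∨ c = Γ'.bit false) ∧
      encodeBlocks ls₁ ++ .bra :: body l₁ = A ++ [c] := by
    rcases List.eq_nil_or_concat l₁ with rfl | ⟨l, a, rfl⟩
    · exact ⟨encodeBlocks ls₁, .bra, by simp, by simp [body]⟩
    · exact ⟨encodeBlocks ls₁ ++ .bra :: (body l ++ bin a), .comma, by simp, by simp [body]⟩
  have hcount : (A ++ [c]).count .comma = ls₁.flatten.length + l₁.length := by
    rw [← hA, List.count_append, List.count_cons, count_comma_encodeBlocks, count_comma_body]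
    simp
  rw [hw, hA] at hk ⊢
  rw [← hcount]
  exact field_eq hc hk

open FinTS in
theorem blockEnd_encodeBlocks (ls₁ ls₂ : List (List ℕ)) (l : List ℕ) :
    blockEnd (encodeBlocks (ls₁ ++ l :: ls₂)) ls₁.length = ls₁.flatten.length + l.length := by
  have hw : encodeBlocks (ls₁ ++ l :: ls₂) =
      (encodeBlocks ls₁ ++ .bra :: body l) ++ .ket :: encodeBlocks ls₂ := by
    simp [encodeBlocks, encodeBlock_eq]
  have hket : (encodeBlocks ls₁ ++ .bra :: body l).count .ket = ls₁.length := by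
    rw [List.count_append, List.count_cons, count_ket_encodeBlocks, count_ket_body]
    simp
  have hcomma : (encodeBlocks ls₁ ++ .bra :: body l).count .comma =
      ls₁.flatten.length + l.length := by
    rw [List.count_append, List.count_cons, count_comma_encodeBlocks, count_comma_body]
    simp
  rw [hw]
  generalize encodeBlocks ls₁ ++ .bra :: body l = A at *
  rw [blockEnd, findGreatest_eq_length_left (A := A), countBefore, List.take_left, hcomma]
  · simp
  · exact ⟨by simp, by rw [countBefore, List.take_left, hket]⟩
  · rintro i hi - ⟨-, h⟩
    have := countBefore_lt (B := encodeBlocks ls₂) (c := .ket) hi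
    omega

/-! ### The separation criterion -/

/-- Whether the state at the position `P` has an outgoing arc: this fails only for the last state
of a path. `N` is the end of the range of the positions. -/
def HasArc (N : ℕ) (cyc : Prop) (P : ℕ) : Prop :=
  P < N - 1 ∨ cyc

/-- Whether the state at the position `P` is outside of the region given by `e`, `p` and `s`: the
letters `W p` and `e` lead out of the region, the letters between the positions `p` and `s` do not
matter, and all other letters lead into the region. -/
def Outside (W : ℕ → ℕ) (e p s P : ℕ) : Prop :=
  ∃ q < P, (W q = W p ∨ W q = e) ∧ ∀ r < P, q < r → ∃ r' < s, p < r' ∧ W r' = W r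

/-- A region that contains the state at `s'` and not the state at `s`. -/
def StateSep (rigid : Prop) (n N : ℕ) (W : ℕ → ℕ) (cyc : Prop) (s s' : ℕ) : Prop :=
  ∃ p < s, (∀ P < N, n ≤ P → HasArc N cyc P → rigid ∧ W P = W p → ¬ Outside W (W p) p s P) ∧
    ¬ Outside W (W p) p s s'

/-- A region, left by the event `e`, that does not contain the state at `s`. -/
def InpSep (rigid : Prop) (n N : ℕ) (W : ℕ → ℕ) (cyc : Prop) (e s : ℕ) : Prop :=
  ∃ p < s, ∀ P < N, n ≤ P → HasArc N cyc P → W P = e ∨ (rigid ∧ W P = W p) →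
    ¬ Outside W e p s P

/-- A region, not left by the event `e`, that contains all sources of `e` and not the state
at `s`. -/
def UsedSep (rigid : Prop) (n N : ℕ) (W : ℕ → ℕ) (cyc : Prop) (e s : ℕ) : Prop :=
  ∃ p < s, W p ≠ e ∧ ∀ P < N, n ≤ P → HasArc N cyc P → W P = e ∨ (rigid ∧ W P = W p) →
    ¬ Outside W (W p) p s P

/-- All states are separated from one another and from the events that they do not enable. -/
def Accept (rigid useInp useUsed : Prop) (n N : ℕ) (W : ℕ → ℕ) (cyc : Prop) : Prop :=
  (∀ s < N, n ≤ s → ∀ s' < N, n ≤ s' → s ≠ s' →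
    StateSep rigid n N W cyc s s' ∨ StateSep rigid n N W cyc s' s) ∧
  ∀ P < N, n ≤ P → HasArc N cyc P → ∀ s < N, n ≤ s → ¬ (HasArc N cyc s ∧ W s = W P) →
    (useInp ∧ InpSep rigid n N W cyc (W P) s) ∨ (useUsed ∧ UsedSep rigid n N W cyc (W P) s)

/-! ### The criterion can be checked in polynomial time -/

/-- The number of states. -/
noncomputable def numStates (w : List Γ') : ℕ :=
  blockEnd w 0

/-- The number of numbers in the first three blocks. -/
noncomputable def arcEnd (w : List Γ') : ℕ :=
  blockEnd w (cadd w 1 1)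

/-- The initial state. -/
noncomputable def initState (w : List Γ') : ℕ :=
  field w (arcEnd w)

/-- There is an arc from `s` to `s'` with the event `e`: for some `k`, the numbers at the places `3k`,
`3k + 1` and `3k + 2` of the third block are `s`, `e` and `s'`. -/
def ArcIn (w : List Γ') (s e s' : ℕ) : Prop :=
  ∃ k < w.length, cadd w (cadd w (cadd w (blockEnd w 1) k) k) k < arcEnd w ∧
    field w (cadd w (cadd w (cadd w (blockEnd w 1) k) k) k) = s ∧
    field w (cadd w (cadd w (cadd w (cadd w (blockEnd w 1) k) k) k) 1) = e ∧
    field w (cadd w (cadd w (cadd w (cadd w (cadd w (blockEnd w 1) k) k) k) 1) 1) = s'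

open Classical in
/-- The state after `s`, which is unique in the case at hand, and `0` if there is none. -/
noncomputable def nextState (w : List Γ') (s : ℕ) : ℕ :=
  Nat.findGreatest (fun s' => ∃ e < w.length, ArcIn w s e s') w.length

open Classical in
/-- The event enabled at `s`, which is unique in the case at hand, and `0` if there is none. -/
noncomputable def eventAt (w : List Γ') (s : ℕ) : ℕ :=
  Nat.findGreatest (fun e => ∃ s' < w.length, ArcIn w s e s') w.length

/-- The state that is reached from the initial state by `i` arcs. -/
noncomputable def stateAt (w : List Γ') (i : ℕ) : ℕ :=
  Nat.rec (initState w) (fun _ s => nextState w s) i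

/-- The initial state has an incoming arc. -/
def IsCycle (w : List Γ') : Prop :=
  ∃ s < w.length, ∃ e < w.length, ArcIn w s e (initState w)

open Classical in
/-- The word of the events of a path or of a cycle, preceded by its past. The state that is reached
by `i` arcs has the position `n + i`, where `n` is the number of states. The past of a cycle
is another round; the past of a path consists of the number `w.length`, which is not an event. -/
noncomputable def letter (w : List Γ') (t : ℕ) : ℕ :=
  if t < numStates w then if IsCycle w then eventAt w (stateAt w t) else w.length
  else eventAt w (stateAt w (t - numStates w))

section Polynomial

variable {k : ℕ} {f g h : List Γ' → (Fin k → ℕ) → ℕ}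

theorem PT.arcEnd : PT fun w (_ : Fin k → ℕ) => arcEnd w :=
  (PT.one.add PT.one).blockEnd

theorem PT.numStates : PT fun w (_ : Fin k → ℕ) => numStates w :=
  PT.zero.blockEnd

theorem PT.initState : PT fun w (_ : Fin k → ℕ) => initState w :=
  PT.arcEnd.field

theorem PTP.arcIn (hf : PT f) (hg : PT g) (hh : PT h) :
    PTP fun w v => ArcIn w (f w v) (g w v) (h w v) := by
  refine PTP.comp₃ (P := ArcIn) (PTP.exists_lt PT.length ?_) hf hg hh
  have h0 : PT fun w (v : Fin 4 → ℕ) =>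
      cadd w (cadd w (cadd w (BoolNet.blockEnd w 1) (v 0)) (v 0)) (v 0) :=
    ((PT.one.blockEnd.add (PT.var 0)).add (PT.var 0)).add (PT.var 0)
  exact (PTP.lt h0 PT.arcEnd).and ((PTP.eq h0.field (PT.var (Fin.succ 0))).and
    ((PTP.eq (h0.add PT.one).field (PT.var (Fin.succ 1))).and
      (PTP.eq ((h0.add PT.one).add PT.one).field (PT.var (Fin.succ 2)))))

theorem PT.nextState (hf : PT f) : PT fun w v => nextState w (f w v) := by
  refine PT.comp₁ (f := BoolNet.nextState) ?_ hf
  classical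
  exact PT.findGreatest (P := fun w s' v => ∃ e < w.length, ArcIn w (v 0) e s')
    (PTP.exists_lt PT.length (PTP.arcIn (PT.var (Fin.succ (Fin.succ 0))) (PT.var 0)
      (PT.var (Fin.succ 0))))

theorem PT.eventAt (hf : PT f) : PT fun w v => eventAt w (f w v) := by
  refine PT.comp₁ (f := BoolNet.eventAt) ?_ hf
  classical
  exact PT.findGreatest (P := fun w e v => ∃ s' < w.length, ArcIn w (v 0) e s')
    (PTP.exists_lt PT.length (PTP.arcIn (PT.var (Fin.succ (Fin.succ 0))) (PT.var (Fin.succ 0))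
      (PT.var 0)))

theorem PT.stateAt (hf : PT f) : PT fun w v => stateAt w (f w v) :=
  PT.natRec PT.initState hf (PT.var 1).nextState

theorem PTP.isCycle : PTP fun w (_ : Fin k → ℕ) => IsCycle w :=
  PTP.exists_lt PT.length (PTP.exists_lt PT.length
    (PTP.arcIn (PT.var 1) (PT.var 0) PT.initState))

theorem PT.letter (hf : PT f) : PT fun w v => letter w (f w v) := by
  classical
  exact (PT.ite (PTP.lt hf PT.numStates) (PT.ite PTP.isCycle hf.stateAt.eventAt PT.length)
    (hf.tsub PT.numStates).stateAt.eventAt).congr fun _ _ _ _ => by congr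

/-- The end of the range of the positions of a word. -/
noncomputable def endPos (w : List Γ') : ℕ :=
  cadd w (numStates w) (numStates w)

theorem PT.endPos : PT fun w (_ : Fin k → ℕ) => endPos w :=
  PT.numStates.add PT.numStates

theorem PTP.hasArc (hf : PT f) : PTP fun w v => HasArc (endPos w) (IsCycle w) (f w v) :=
  (PTP.lt hf (PT.endPos.tsub PT.one)).or PTP.isCycle

theorem PTP.outside {i : List Γ' → (Fin k → ℕ) → ℕ} (hf : PT f) (hg : PT g) (hh : PT h)
    (hi : PT i) : PTP fun w v => Outside (letter w) (f w v) (g w v) (h w v) (i w v) := by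
  refine PTP.comp₄ (P := fun w => Outside (letter w)) ?_ hf hg hh hi
  exact PTP.exists_lt (PT.var 3) (.and (.or (.eq (PT.var 0).letter (PT.var (Fin.succ 1)).letter)
    (.eq (PT.var 0).letter (PT.var (Fin.succ 0)))) (PTP.forall_lt (PT.var (Fin.succ 3))
      (.imp (.lt (PT.var 1) (PT.var 0)) (PTP.exists_lt (PT.var (Fin.succ (Fin.succ 2)))
        (.and (.lt (PT.var (Fin.succ (Fin.succ (Fin.succ 1)))) (PT.var 0))
          (.eq (PT.var 0).letter (PT.var 1).letter))))))

variable (rigid : Prop)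

theorem PTP.stateSep (hf : PT f) (hg : PT g) : PTP fun w v =>
    StateSep rigid (numStates w) (endPos w) (letter w) (IsCycle w) (f w v) (g w v) := by
  refine PTP.comp₂ (P := fun w => StateSep rigid (numStates w) (endPos w) (letter w) (IsCycle w))
    ?_ hf hg
  have p2 : PT fun _ (v : Fin 4 → ℕ) => v 1 := PT.var 1
  exact PTP.exists_lt (PT.var 0) (.and (PTP.forall_lt PT.endPos (.imp (.le PT.numStates (PT.var 0))
    (.imp (PTP.hasArc (PT.var 0)) (.imp (.and (.const rigid) (.eq (PT.var 0).letter p2.letter))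
      (PTP.outside p2.letter p2 (PT.var (Fin.succ (Fin.succ 0))) (PT.var 0)).not))))
    (PTP.outside (PT.var 0).letter (PT.var 0) (PT.var (Fin.succ 0)) (PT.var (Fin.succ 1))).not)

theorem PTP.inpSep (hf : PT f) (hg : PT g) : PTP fun w v =>
    InpSep rigid (numStates w) (endPos w) (letter w) (IsCycle w) (f w v) (g w v) := by
  refine PTP.comp₂ (P := fun w => InpSep rigid (numStates w) (endPos w) (letter w) (IsCycle w))
    ?_ hf hg
  have p2 : PT fun _ (v : Fin 4 → ℕ) => v 1 := PT.var 1
  have pe : PT fun _ (v : Fin 4 → ℕ) => v (Fin.succ (Fin.succ 0)) := PT.var _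
  exact PTP.exists_lt (PT.var 1) (PTP.forall_lt PT.endPos (.imp (.le PT.numStates (PT.var 0))
    (.imp (PTP.hasArc (PT.var 0)) (.imp (.or (.eq (PT.var 0).letter pe)
      (.and (.const rigid) (.eq (PT.var 0).letter p2.letter)))
        (PTP.outside pe p2 (PT.var (Fin.succ (Fin.succ 1))) (PT.var 0)).not))))

theorem PTP.usedSep (hf : PT f) (hg : PT g) : PTP fun w v =>
    UsedSep rigid (numStates w) (endPos w) (letter w) (IsCycle w) (f w v) (g w v) := by
  refine PTP.comp₂ (P := fun w => UsedSep rigid (numStates w) (endPos w) (letter w) (IsCycle w))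
    ?_ hf hg
  have p2 : PT fun _ (v : Fin 4 → ℕ) => v 1 := PT.var 1
  have pe : PT fun _ (v : Fin 4 → ℕ) => v (Fin.succ (Fin.succ 0)) := PT.var _
  exact PTP.exists_lt (PT.var 1) (.and (PTP.eq (PT.var 0).letter (PT.var (Fin.succ 0))).not
    (PTP.forall_lt PT.endPos (.imp (.le PT.numStates (PT.var 0))
    (.imp (PTP.hasArc (PT.var 0)) (.imp (.or (.eq (PT.var 0).letter pe)
      (.and (.const rigid) (.eq (PT.var 0).letter p2.letter)))
        (PTP.outside p2.letter p2 (PT.var (Fin.succ (Fin.succ 1))) (PT.var 0)).not)))))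

theorem PTP.accept (useInp useUsed : Prop) : PTP fun w (_ : Fin k → ℕ) =>
    Accept rigid useInp useUsed (numStates w) (endPos w) (letter w) (IsCycle w) := by
  have v0 : ∀ {j}, PT fun _ (v : Fin (j + 1) → ℕ) => v 0 := PT.var 0
  have v1 : ∀ {j}, PT fun _ (v : Fin (j + 2) → ℕ) => v 1 := PT.var 1
  refine .and (.forall_lt PT.endPos (.imp (.le PT.numStates v0) (.forall_lt PT.endPos
    (.imp (.le PT.numStates v0) (.imp (PTP.eq v1 v0).not
      (.or (PTP.stateSep rigid v1 v0) (PTP.stateSep rigid v0 v1)))))))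
    (.forall_lt PT.endPos (.imp (.le PT.numStates v0) (.imp (PTP.hasArc v0)
      (.forall_lt PT.endPos (.imp (.le PT.numStates v0)
        (.imp (PTP.and (PTP.hasArc v0) (.eq v0.letter v1.letter)).not
          (.or (.and (.const useInp) (PTP.inpSep rigid v1.letter v0))
            (.and (.const useUsed) (PTP.usedSep rigid v1.letter v0)))))))))

end Polynomial

/-! ### The encoding of a transition system -/

namespace FinTS

variable (A : FinTS)

/-- The arcs of `A` as a relation between numbers. -/
def Arc (s e s' : ℕ) : Prop :=
  ∃ a b c, A.ts.δ a b = some c ∧ (a : ℕ) = s ∧ (b : ℕ) = e ∧ (c : ℕ) = s'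

/-- The numbers in the block of the arcs. -/
def arcNumbers : List ℕ :=
  A.arcs.flatMap fun a => [(a.1 : ℕ), (a.2.1 : ℕ), (a.2.2 : ℕ)]

/-- The blocks of the description of `A`. -/
def blocks : List (List ℕ) :=
  [(List.finRange A.n).map fun s : Fin A.n => (s : ℕ),
    (List.finRange A.m).map fun e : Fin A.m => (e : ℕ), A.arcNumbers, [(A.ts.s₀ : ℕ)]]

theorem encode_eq : A.encode = encodeBlocks A.blocks := by
  have h : ∀ n, (List.finRange n).flatMap (fun a : Fin n => [(a : ℕ)]) = List.range n := fun n => by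
    rw [← List.map_coe_finRange_eq_range, List.map_eq_flatMap]
  simp [encode, encodeBlocks, blocks, arcNumbers, h]

theorem length_arcNumbers : A.arcNumbers.length = 3 * A.arcs.length := by
  rw [arcNumbers]
  induction A.arcs with
  | nil => rfl
  | cons a l ih =>
    rw [List.flatMap_cons, List.length_append, ih]
    simp
    omega

theorem mem_arcs {a : Fin A.n × Fin A.m × Fin A.n} :
    a ∈ A.arcs ↔ A.ts.δ a.1 a.2.1 = some a.2.2 := by
  obtain ⟨s, e, s'⟩ := a
  simp [arcs]

/-- Every state but the initial one has an incoming arc. -/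
theorem n_le_length_arcs : A.n ≤ A.arcs.length + 1 := by
  have h : (Finset.univ.erase A.ts.s₀) ⊆ (A.arcs.map fun a => a.2.2).toFinset := by
    intro s hs
    rw [List.mem_toFinset, List.mem_map]
    obtain h | ⟨s', -, e, he⟩ := (A.ts.reachable s).cases_tail
    · exact absurd h (Finset.ne_of_mem_erase hs)
    · exact ⟨(s', e, s), A.mem_arcs.2 he, rfl⟩
  have := (Finset.card_le_card h).trans (List.toFinset_card_le _)
  rw [Finset.card_erase_of_mem (Finset.mem_univ _), Finset.card_univ, Fintype.card_fin,
    List.length_map] at this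
  omega

/-- There is a comma after every number, and a bracket after each of the four blocks. -/
theorem le_length_encode : A.n + A.m + 3 * A.arcs.length + 5 ≤ A.encode.length := by
  have h : (A.encode.count .comma) + (A.encode.count .ket) ≤ A.encode.length := by
    generalize A.encode = w
    induction w with
    | nil => simp
    | cons c w ih =>
      rw [List.count_cons, List.count_cons, List.length_cons]
      cases c <;> simp <;> omega
  rw [encode_eq, count_comma_encodeBlocks, count_ket_encodeBlocks] at h
  rw [encode_eq]
  simp only [blocks, List.flatten_cons, List.length_append, List.length_map, List.length_finRange,
    length_arcNumbers, List.length_cons, List.length_nil, List.flatten_nil] at h ⊢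
  omega

theorem two_mul_n_le : A.n + A.n ≤ A.encode.length := by
  have := A.n_le_length_arcs
  have := A.le_length_encode
  omega

theorem numStates_encode : numStates A.encode = A.n := by
  rw [encode_eq, blocks]
  exact (blockEnd_encodeBlocks [] _ _).trans (by simp)

theorem endPos_encode : endPos A.encode = A.n + A.n := by
  rw [endPos, numStates_encode]
  exact Nat.min_eq_left A.two_mul_n_le

theorem blockEnd_one_encode : blockEnd A.encode 1 = A.n + A.m := by
  rw [encode_eq, blocks]
  exact (blockEnd_encodeBlocks [_] _ _).trans (by simp)

theorem arcEnd_encode : arcEnd A.encode = A.n + A.m + 3 * A.arcs.length := by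
  have h : cadd A.encode 1 1 = 2 := by
    have := A.le_length_encode
    exact Nat.min_eq_left (by omega)
  rw [arcEnd, h, encode_eq, blocks]
  exact (blockEnd_encodeBlocks [_, _] _ _).trans (by simp [length_arcNumbers, add_assoc])

theorem initState_encode : initState A.encode = A.ts.s₀ := by
  have h0 := A.le_length_encode
  have h1 := A.ts.s₀.2
  have := field_encodeBlocks [(List.finRange A.n).map fun s : Fin A.n => (s : ℕ),
    (List.finRange A.m).map fun e : Fin A.m => (e : ℕ), A.arcNumbers] [] [] [] (A.ts.s₀ : ℕ)
    (by
      rw [encode_eq, blocks] at h0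
      exact le_trans (by omega) h0)
  rw [initState, arcEnd_encode]
  rw [encode_eq, blocks]
  refine Eq.trans ?_ this
  congr 1
  simp [length_arcNumbers, add_assoc]

theorem field_encode_arc {l₁ l₂ : List (Fin A.n × Fin A.m × Fin A.n)}
    {a : Fin A.n × Fin A.m × Fin A.n} (h : A.arcs = l₁ ++ a :: l₂) :
    field A.encode (A.n + A.m + 3 * l₁.length) = a.1 ∧
    field A.encode (A.n + A.m + 3 * l₁.length + 1) = a.2.1 ∧
    field A.encode (A.n + A.m + 3 * l₁.length + 2) = a.2.2 := by
  have h0 := A.le_length_encode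
  have h1 := a.1.2
  have h2 := a.2.1.2
  have h3 := a.2.2.2
  have hlen : (l₁.flatMap fun a => [(a.1 : ℕ), (a.2.1 : ℕ), (a.2.2 : ℕ)]).length =
      3 * l₁.length := by
    clear h
    induction l₁ with
    | nil => rfl
    | cons a l ih =>
      rw [List.flatMap_cons, List.length_append, ih]
      simp
      omega
  have key : ∀ (m₁ m₂ : List ℕ) (k j : ℕ), A.arcNumbers = m₁ ++ k :: m₂ → k < A.n + A.m →
      m₁.length = 3 * l₁.length + j → field A.encode (A.n + A.m + 3 * l₁.length + j) = k := by
    intro m₁ m₂ k j hm hk hj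
    have := field_encodeBlocks [(List.finRange A.n).map fun s : Fin A.n => (s : ℕ),
      (List.finRange A.m).map fun e : Fin A.m => (e : ℕ)] [[(A.ts.s₀ : ℕ)]] m₁ m₂ k
      (by
        rw [encode_eq, blocks, hm] at h0
        exact le_trans (by omega) h0)
    rw [encode_eq, blocks, hm]
    refine Eq.trans ?_ this
    congr 1
    simp [hj, add_assoc]
  have hA : A.arcNumbers = (l₁.flatMap fun a => [(a.1 : ℕ), (a.2.1 : ℕ), (a.2.2 : ℕ)]) ++
      (a.1 : ℕ) :: (a.2.1 : ℕ) :: (a.2.2 : ℕ) ::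
      (l₂.flatMap fun a => [(a.1 : ℕ), (a.2.1 : ℕ), (a.2.2 : ℕ)]) := by
    rw [arcNumbers, h]
    simp
  generalize (l₁.flatMap fun a => [(a.1 : ℕ), (a.2.1 : ℕ), (a.2.2 : ℕ)]) = m₁ at *
  refine ⟨key m₁ _ _ 0 hA (by omega) hlen, key (m₁ ++ [(a.1 : ℕ)]) _ _ 1
    (by rw [hA, List.append_assoc]; rfl) (by omega) (by simp [hlen]),
    key (m₁ ++ [(a.1 : ℕ), (a.2.1 : ℕ)]) _ _ 2
    (by rw [hA, List.append_assoc]; rfl) (by omega) (by simp [hlen])⟩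

theorem arcIn_encode (s e s' : ℕ) : ArcIn A.encode s e s' ↔ A.Arc s e s' := by
  have h0 := A.le_length_encode
  have hc : ∀ a b, a + b ≤ A.encode.length → cadd A.encode a b = a + b :=
    fun a b h => Nat.min_eq_left h
  have hpos : ∀ k, A.n + A.m + 3 * k < A.n + A.m + 3 * A.arcs.length →
      cadd A.encode (cadd A.encode (cadd A.encode (A.n + A.m) k) k) k = A.n + A.m + 3 * k ∧
      cadd A.encode (A.n + A.m + 3 * k) 1 = A.n + A.m + 3 * k + 1 ∧
      cadd A.encode (A.n + A.m + 3 * k + 1) 1 = A.n + A.m + 3 * k + 2 := by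
    intro k hk
    rw [hc (A.n + A.m) k (by omega), hc (A.n + A.m + k) k (by omega),
      hc (A.n + A.m + k + k) k (by omega), hc (A.n + A.m + 3 * k) 1 (by omega),
      hc (A.n + A.m + 3 * k + 1) 1 (by omega)]
    omega
  have hk : ∀ k, (k < A.encode.length ∧
      cadd A.encode (cadd A.encode (cadd A.encode (A.n + A.m) k) k) k <
        A.n + A.m + 3 * A.arcs.length) ↔ k < A.arcs.length := by
    intro k
    simp only [cadd]
    omega
  rw [ArcIn, blockEnd_one_encode, arcEnd_encode]
  constructor
  · rintro ⟨k, hk1, hk2, h1, h2, h3⟩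
    have hk := (hk k).1 ⟨hk1, hk2⟩
    obtain ⟨e1, e2, e3⟩ := hpos k (by omega)
    rw [e1] at h1
    rw [e1, e2] at h2
    rw [e1, e2, e3] at h3
    obtain ⟨f1, f2, f3⟩ := A.field_encode_arc (l₁ := A.arcs.take k) (l₂ := A.arcs.drop (k + 1))
      (a := A.arcs[k]) (by rw [← List.drop_eq_getElem_cons hk, List.take_append_drop])
    rw [List.length_take, Nat.min_eq_left hk.le] at f1 f2 f3
    exact ⟨_, _, _, A.mem_arcs.1 (List.getElem_mem hk), f1.symm.trans h1, f2.symm.trans h2,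
      f3.symm.trans h3⟩
  · rintro ⟨a, b, c, habc, rfl, rfl, rfl⟩
    obtain ⟨l₁, l₂, h⟩ := List.append_of_mem (A.mem_arcs (a := (a, b, c)).2 habc)
    have hl : l₁.length < A.arcs.length := by
      rw [h]
      simp
    obtain ⟨f1, f2, f3⟩ := A.field_encode_arc h
    obtain ⟨e1, e2, e3⟩ := hpos l₁.length (by omega)
    refine ⟨l₁.length, by omega, by omega, ?_⟩
    rw [e1, e2, e3]
    exact ⟨f1, f2, f3⟩

theorem encode_ne_nil : A.encode ≠ [] := by
  have := A.le_length_encode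
  rw [← List.length_pos_iff]
  omega

theorem Arc.lt {A : FinTS} {s e s' : ℕ} (h : A.Arc s e s') : s < A.n ∧ e < A.m ∧ s' < A.n := by
  obtain ⟨a, b, c, -, rfl, rfl, rfl⟩ := h
  exact ⟨a.2, b.2, c.2⟩

end FinTS

/-! ### Transition systems with at most one arc into and out of each state -/

/-- `A` is a path or a cycle: `x i` is the state after `i` arcs from the initial state, and `ev i` is
the event of the arc from `x i` to `x (i + 1)`. The last state of a path has no outgoing arc. -/
structure IsLinear (A : FinTS) (x ev : ℕ → ℕ) (cyc : Prop) : Prop where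
  init : x 0 = A.ts.s₀
  lt : ∀ i < A.n, x i < A.n
  inj : ∀ i < A.n, ∀ j < A.n, x i = x j → i = j
  surj : ∀ s < A.n, ∃ i < A.n, x i = s
  arc : ∀ i < A.n, i + 1 < A.n ∨ cyc → A.Arc (x i) (ev i) (x (i + 1))
  eq_of_arc : ∀ i < A.n, ∀ e s', A.Arc (x i) e s' → (i + 1 < A.n ∨ cyc) ∧ e = ev i
  closed : cyc → x A.n = x 0

namespace FinTS

variable {A : FinTS}

theorem Arc.eq_right (hA : A.ts.IsBounded 1) {s e s' e₁ s₁ : ℕ} (h : A.Arc s e s')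
    (h' : A.Arc s e₁ s₁) : e = e₁ ∧ s' = s₁ := by
  obtain ⟨a, b, c, hδ, rfl, rfl, rfl⟩ := h
  obtain ⟨a', b', c', hδ', haa, rfl, rfl⟩ := h'
  obtain rfl := Fin.ext haa
  have : b = b' := Set.encard_le_one_iff.1 (hA a').2 b b' (by simp [hδ]) (by simp [hδ'])
  subst this
  rw [hδ] at hδ'
  exact ⟨rfl, congrArg Fin.val (Option.some.inj hδ')⟩

theorem Arc.eq_left (hA : A.ts.IsBounded 1) {s e s' e₁ s₁ : ℕ} (h : A.Arc s e s')
    (h' : A.Arc s₁ e₁ s') : s = s₁ := by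
  obtain ⟨a, b, c, hδ, rfl, rfl, rfl⟩ := h
  obtain ⟨a', b', c', hδ', rfl, rfl, hcc⟩ := h'
  obtain rfl := Fin.ext hcc
  have := Set.encard_le_one_iff.1 (hA c').1 (a, b) (a', b') hδ hδ'
  exact congrArg (fun p => (p.1 : ℕ)) this

theorem Arc.lt_length {s e s' : ℕ} (h : A.Arc s e s') :
    s < A.encode.length ∧ e < A.encode.length ∧ s' < A.encode.length := by
  have := h.lt
  have := A.le_length_encode
  omega

theorem Arc.nextState_eq (hA : A.ts.IsBounded 1) {s e s' : ℕ} (h : A.Arc s e s') :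
    nextState A.encode s = s' := by
  have hl := h.lt_length
  classical
  rw [nextState, Nat.findGreatest_eq_iff]
  refine ⟨hl.2.2.le, fun _ => ⟨e, hl.2.1, (A.arcIn_encode _ _ _).2 h⟩, ?_⟩
  rintro i hi - ⟨e', -, h'⟩
  exact hi.ne (h.eq_right hA ((A.arcIn_encode _ _ _).1 h')).2

theorem Arc.eventAt_eq (hA : A.ts.IsBounded 1) {s e s' : ℕ} (h : A.Arc s e s') :
    eventAt A.encode s = e := by
  have hl := h.lt_length
  classical
  rw [eventAt, Nat.findGreatest_eq_iff]
  refine ⟨hl.2.1.le, fun _ => ⟨s', hl.2.2, (A.arcIn_encode _ _ _).2 h⟩, ?_⟩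
  rintro i hi - ⟨e', -, h'⟩
  exact hi.ne (h.eq_right hA ((A.arcIn_encode _ _ _).1 h')).1

theorem isCycle_encode : IsCycle A.encode ↔ ∃ s e, A.Arc s e A.ts.s₀ := by
  simp only [IsCycle, initState_encode, arcIn_encode]
  exact ⟨fun ⟨s, _, e, _, h⟩ => ⟨s, e, h⟩,
    fun ⟨s, e, h⟩ => ⟨s, h.lt_length.1, e, h.lt_length.2.1, h⟩⟩

/-- Following the arcs from the initial state leads through all states of a path or of a cycle. -/
theorem isLinear_encode (hA : A.ts.IsBounded 1) :
    IsLinear A (stateAt A.encode) (fun i => eventAt A.encode (stateAt A.encode i))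
      (IsCycle A.encode) := by
  rw [isCycle_encode]
  set x := stateAt A.encode with hx
  have hx0 : x 0 = A.ts.s₀ := A.initState_encode
  have hxs : ∀ {i e s'}, A.Arc (x i) e s' → x (i + 1) = s' := fun h => h.nextState_eq hA
  -- `V i`: the first `i` arcs from the initial state exist.
  let V : ℕ → Prop := fun i => ∀ j < i, ∃ e s', A.Arc (x j) e s'
  have hV : ∀ {i j}, V i → j ≤ i → V j := fun h hj k hk => h k (by omega)
  have hVs : ∀ {i e s'}, V i → A.Arc (x i) e s' → V (i + 1) := by
    intro i e s' h h' j hj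
    rcases Nat.lt_succ_iff_lt_or_eq.1 hj with hj | rfl
    · exact h j hj
    · exact ⟨e, s', h'⟩
  have harc : ∀ {i}, V (i + 1) → A.Arc (x i) (eventAt A.encode (x i)) (x (i + 1)) := by
    intro i h
    obtain ⟨e, s', h'⟩ := h i i.lt_succ_self
    rwa [h'.eventAt_eq hA, hxs h']
  have hlt : ∀ {i}, V i → x i < A.n := by
    intro i h
    cases i with
    | zero => rw [hx0]; exact A.ts.s₀.2
    | succ i => exact (harc h).lt.2.2
  have hreach : ∀ s : Fin A.n, ∃ i, V i ∧ x i = s := by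
    intro s
    induction A.ts.reachable s with
    | refl => exact ⟨0, fun j hj => absurd hj (by omega), hx0⟩
    | tail _ h ih =>
      obtain ⟨e, he⟩ := h
      obtain ⟨i, hi, hi'⟩ := ih
      have ha : A.Arc (x i) e _ := ⟨_, e, _, he, hi'.symm, rfl, rfl⟩
      exact ⟨i + 1, hVs hi ha, hxs ha⟩
  -- As states have at most one incoming arc, equal states have equal pasts.
  have hback : ∀ i d, V (i + d) → x i = x (i + d) → x 0 = x d := by
    intro i d h h'
    induction i with
    | zero => simpa using h'
    | succ i ih =>
      rw [show i + 1 + d = i + d + 1 by omega] at h h'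
      exact ih (hV h (by omega)) ((harc (hV h (by omega))).eq_left hA (h' ▸ harc h))
  by_cases hc : ∃ s e, A.Arc s e A.ts.s₀
  · -- The length of a cycle is the least period of `x`.
    have hper : ∃ p, 0 < p ∧ V p ∧ x p = x 0 := by
      obtain ⟨s, e, h⟩ := hc
      obtain ⟨i, hi, hi'⟩ := hreach ⟨s, h.lt.1⟩
      have ha : A.Arc (x i) e (A.ts.s₀ : ℕ) := hi' ▸ h
      exact ⟨i + 1, by omega, hVs hi ha, (hxs ha).trans hx0.symm⟩
    classical
    obtain ⟨hp0, hpV, hpx⟩ := Nat.find_spec hper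
    have hmin : ∀ q < Nat.find hper, ¬ (0 < q ∧ V q ∧ x q = x 0) := fun q hq => Nat.find_min hper hq
    generalize Nat.find hper = p at *
    have hall : ∀ i, x (i + p) = x i := by
      intro i
      induction i with
      | zero => simpa using hpx
      | succ i ih =>
        rw [show i + 1 + p = i + p + 1 by omega]
        exact congrArg (nextState A.encode) ih
    have hmod : ∀ i, x i = x (i % p) := by
      intro i
      induction i using Nat.strong_induction_on with
      | _ i ih =>
        by_cases hi : i < p
        · rw [Nat.mod_eq_of_lt hi]
        · obtain ⟨j, rfl⟩ : ∃ j, i = j + p := ⟨i - p, by omega⟩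
          rw [hall, ih j (by omega), Nat.add_mod_right]
    have hinj : ∀ i < p, ∀ j < p, x i = x j → i = j := by
      have : ∀ i j, i < j → j < p → x i ≠ x j := by
        intro i j hij hj h
        have := hback i (j - i) (hV hpV (by omega)) (by rwa [Nat.add_sub_cancel' hij.le])
        exact hmin (j - i) (by omega) ⟨by omega, hV hpV (by omega), this.symm⟩
      intro i hi j hj h
      rcases lt_trichotomy i j with h' | h' | h'
      · exact absurd h (this i j h' hj)
      · exact h'
      · exact absurd h.symm (this j i h' hi)
    have hpn : p = A.n := by
      apply le_antisymm
      · have := Fintype.card_le_of_injective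
          (fun i : Fin p => (⟨x i, hlt (hV hpV i.2.le)⟩ : Fin A.n))
          (fun i j h => Fin.ext (hinj i i.2 j j.2 (congrArg Fin.val h)))
        simpa using this
      · have := Fintype.card_le_of_surjective
          (fun i : Fin p => (⟨x i, hlt (hV hpV i.2.le)⟩ : Fin A.n))
          (fun s => by
            obtain ⟨i, -, hi⟩ := hreach s
            exact ⟨⟨i % p, Nat.mod_lt _ hp0⟩, Fin.ext ((hmod i).symm.trans hi)⟩)
        simpa using this
    subst hpn
    refine ⟨hx0, fun i hi => hlt (hV hpV hi.le), hinj, fun s hs => ?_,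
      fun i hi _ => harc (hV hpV hi), fun i hi e s' h => ⟨.inr hc, (h.eventAt_eq hA).symm⟩,
      fun _ => hpx⟩
    obtain ⟨i, -, hi⟩ := hreach ⟨s, hs⟩
    exact ⟨i % A.n, Nat.mod_lt _ hp0, (hmod i).symm.trans hi⟩
  · -- In a path, the initial state has no incoming arc, so that no state occurs twice.
    have hne : ∀ d, 0 < d → V d → x 0 ≠ x d := by
      intro d hd h h'
      obtain ⟨d, rfl⟩ : ∃ d', d = d' + 1 := ⟨d - 1, by omega⟩
      refine hc ⟨x d, eventAt A.encode (x d), ?_⟩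
      rw [← hx0, h']
      exact harc h
    have hinj : ∀ i j, V i → V j → x i = x j → i = j := by
      have : ∀ i j, i < j → V j → x i ≠ x j := by
        intro i j hij hj h
        exact hne (j - i) (by omega) (hV hj (by omega))
          (hback i (j - i) (by rwa [Nat.add_sub_cancel' hij.le])
            (by rwa [Nat.add_sub_cancel' hij.le]))
      intro i j hi hj h
      rcases lt_trichotomy i j with h' | h' | h'
      · exact absurd h (this i j h' hj)
      · exact h'
      · exact absurd h.symm (this j i h' hi)
    have hVn : ∀ i, V i ↔ i < A.n := by
      intro i
      constructor
      · intro h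
        have := Fintype.card_le_of_injective
          (fun j : Fin (i + 1) => (⟨x j, hlt (hV h (by omega))⟩ : Fin A.n))
          (fun j k h' => Fin.ext (hinj j k (hV h (by omega)) (hV h (by omega))
            (congrArg Fin.val h')))
        simpa using this
      · intro h
        by_contra hi
        choose f hf hf' using hreach
        have hfi : ∀ s, f s < i := fun s => by
          by_contra h'
          exact hi (hV (hf s) (by omega))
        have := Fintype.card_le_of_injective (fun s : Fin A.n => (⟨f s, hfi s⟩ : Fin i))
          (fun s t h' => by
            have : f s = f t := congrArg Fin.val h'
            exact Fin.ext ((hf' s).symm.trans ((congrArg x this).trans (hf' t))))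
        simp at this
        omega
    refine ⟨hx0, fun i hi => hlt ((hVn i).2 hi),
      fun i hi j hj h => hinj i j ((hVn i).2 hi) ((hVn j).2 hj) h, fun s hs => ?_,
      fun i hi h => harc ((hVn _).2 (h.resolve_right hc)),
      fun i hi e s' h => ⟨.inl ((hVn _).1 (hVs ((hVn i).2 hi) h)), (h.eventAt_eq hA).symm⟩,
      fun h => absurd h hc⟩
    obtain ⟨i, hi, hi'⟩ := hreach ⟨s, hs⟩
    exact ⟨i, (hVn i).1 hi, hi'⟩

end FinTS

/-! ### Regions -/

/-- A region: a set of states and an interaction for each event such that every arc acts on the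
membership in the set by the interaction of its event. -/
def InitTS.IsRegion {S E : Type} (A : InitTS S E) (sup : S → Bool) (sig : E → Interaction) : Prop :=
  ∀ s e s', A.δ s e = some s' → (sig e).app (sup s) = some (sup s')

/-- The interactions are finite in number. -/
theorem Interaction.finite : Finite Interaction := by
  refine Finite.of_injective (fun i : Interaction => (i.app true, i.app false)) ?_
  intro i j h
  cases i <;> cases j <;> simp_all [Interaction.app]

namespace InitTS

variable {S E : Type} (A : InitTS S E) (τ : Set Interaction)

/-- The interactions of a net with the marking in bijection with the states read off at one place
form a region. -/
theorem isRegion_of_iso {P T : Type} {N : Net τ P T} (φ : A.Iso N.reachabilityGraph) (p : P) :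
    A.IsRegion (fun s => (φ.onStates s).1 p) (fun e => N.f p (φ.onEvents e)) := by
  intro s e s' h
  have hδ := φ.map_δ s e
  rw [h, Option.map_some] at hδ
  have hf : N.fire (φ.onStates s).1 (φ.onEvents e) = some (φ.onStates s').1 := by
    simp only [Net.reachabilityGraph, Option.pmap_eq_some_iff] at hδ
    obtain ⟨M, h1, h2, h3⟩ := hδ
    rw [h2]
    exact congrArg some (congrArg Subtype.val h3).symm
  rw [Net.fire] at hf
  split_ifs at hf with hen
  have := congrFun (Option.some.inj hf) p
  change (N.f p (φ.onEvents e) : Interaction).app ((φ.onStates s).1 p) =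
    some ((φ.onStates s').1 p)
  rw [← this, Option.some_get]

/-- A transition system is solvable if and only if every two states are separated by a region, and
every event is prevented by a region at every state that does not enable it. -/
theorem solvable_iff [Finite S] [Finite E] : A.Solvable τ ↔
    (∀ s s', s ≠ s' → ∃ sup sig, A.IsRegion sup sig ∧ (∀ e, sig e ∈ τ) ∧ sup s ≠ sup s') ∧
    ∀ s e, A.δ s e = none →
      ∃ sup sig, A.IsRegion sup sig ∧ (∀ e, sig e ∈ τ) ∧ (sig e).app (sup s) = none := by
  constructor
  · rintro ⟨P, T, -, -, N, ⟨φ⟩⟩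
    constructor
    · intro s s' hs
      have : (φ.onStates s).1 ≠ (φ.onStates s').1 := fun h =>
        hs (φ.onStates.injective (Subtype.ext h))
      obtain ⟨p, hp⟩ := Function.ne_iff.1 this
      exact ⟨_, _, A.isRegion_of_iso τ φ p, fun e => (N.f p (φ.onEvents e)).2, hp⟩
    · intro s e he
      have hδ := φ.map_δ s e
      rw [he, Option.map_none] at hδ
      have hf : N.fire (φ.onStates s).1 (φ.onEvents e) = none := by
        simpa [Net.reachabilityGraph] using hδ
      rw [Net.fire] at hf
      split_ifs at hf with hen
      push Not at hen
      obtain ⟨p, hp⟩ := hen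
      exact ⟨_, _, A.isRegion_of_iso τ φ p, fun e => (N.f p (φ.onEvents e)).2,
        Option.not_isSome_iff_eq_none.1 hp⟩
  · rintro ⟨hssp, hessp⟩
    have := Interaction.finite
    let N : Net τ {r : (S → Bool) × (E → τ) // A.IsRegion r.1 fun e => r.2 e} E :=
      ⟨fun r => r.1.1 A.s₀, fun r e => r.1.2 e⟩
    let mk : S → {r : (S → Bool) × (E → τ) // A.IsRegion r.1 fun e => r.2 e} → Bool :=
      fun s r => r.1.1 s
    have hfire : ∀ s e, N.fire (mk s) e = (A.δ s e).map mk := by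
      intro s e
      cases he : A.δ s e with
      | none =>
        obtain ⟨sup, sig, hr, hτ, h⟩ := hessp s e he
        rw [Net.fire, dif_neg, Option.map_none]
        intro hen
        have := hen ⟨(sup, fun e => ⟨sig e, hτ e⟩), hr⟩
        rw [show ((N.f ⟨(sup, fun e => ⟨sig e, hτ e⟩), hr⟩ e : τ) : Interaction).app
          (mk s ⟨(sup, fun e => ⟨sig e, hτ e⟩), hr⟩) = none from h] at this
        simp at this
      | some s' =>
        have h : ∀ r, ((N.f r e : τ) : Interaction).app (mk s r) = some (mk s' r) :=
          fun r => r.2 s e s' he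
        rw [Net.fire, dif_pos fun r => by rw [h r]; rfl, Option.map_some]
        congr 1
        funext r
        simp [h r]
    have hmk : Function.Injective mk := by
      intro s s' h
      by_contra hs
      obtain ⟨sup, sig, hr, hτ, h'⟩ := hssp s s' hs
      exact h' (congrFun h ⟨(sup, fun e => ⟨sig e, hτ e⟩), hr⟩)
    have hreach : ∀ s, N.IsReachable (mk s) := by
      intro s
      induction A.reachable s with
      | refl => exact N.isReachable_init
      | tail _ h ih =>
        obtain ⟨e, he⟩ := h
        exact ih.fire (t := e) (by rw [hfire, he, Option.map_some])
    have hsurj : ∀ M, N.IsReachable M → ∃ s, mk s = M := by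
      intro M hM
      induction hM with
      | refl => exact ⟨A.s₀, rfl⟩
      | tail _ h ih =>
        obtain ⟨t, ht⟩ := h
        obtain ⟨s, rfl⟩ := ih
        rw [hfire, Option.map_eq_some_iff] at ht
        obtain ⟨s', -, h⟩ := ht
        exact ⟨s', h⟩
    refine ⟨_, E, inferInstance, inferInstance, N, ⟨?_⟩⟩
    refine ⟨Equiv.ofBijective (fun s => ⟨mk s, hreach s⟩) ⟨fun s s' h =>
      hmk (congrArg Subtype.val h), fun M => ?_⟩, Equiv.refl E, rfl, fun s e => ?_⟩
    · obtain ⟨s, hs⟩ := hsurj M.1 M.2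
      exact ⟨s, Subtype.ext hs⟩
    · have h := hfire s e
      simp only [Net.reachabilityGraph, Equiv.refl_apply]
      cases he : A.δ s e with
      | none =>
        rw [he, Option.map_none] at h
        simp only [Option.map_none, Option.pmap_eq_none_iff]
        exact h
      | some s' =>
        rw [he, Option.map_some] at h
        simp only [Option.map_some, Option.pmap_eq_some_iff]
        exact ⟨mk s', h, h, rfl⟩

end InitTS

/-! ### Duality -/

/-- The interaction that acts on the complement. -/
def Interaction.dual : Interaction → Interaction
  | .nop => .nop
  | .inp => .out
  | .out => .inp
  | .set => .res
  | .res => .set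
  | .swap => .swap
  | .used => .free
  | .free => .used

theorem Interaction.app_dual (i : Interaction) (x : Bool) :
    i.dual.app (!x) = (i.app x).map (!·) := by
  cases i <;> cases x <;> rfl

@[simp]
theorem Interaction.dual_dual (i : Interaction) : i.dual.dual = i := by
  cases i <;> rfl

variable {S E : Type} {A : InitTS S E}

theorem InitTS.IsRegion.dual {sup : S → Bool} {sig : E → Interaction} (h : A.IsRegion sup sig) :
    A.IsRegion (fun s => !sup s) fun e => (sig e).dual := fun s e s' he => by
  rw [Interaction.app_dual, h s e s' he, Option.map_some]

theorem InitTS.Solvable.dual [Finite S] [Finite E] {τ τ' : Set Interaction}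
    (hτ : ∀ i ∈ τ, i.dual ∈ τ') (h : A.Solvable τ) : A.Solvable τ' := by
  rw [InitTS.solvable_iff] at h ⊢
  refine ⟨fun s s' hs => ?_, fun s e he => ?_⟩
  · obtain ⟨sup, sig, hr, hsig, h⟩ := h.1 s s' hs
    exact ⟨_, _, hr.dual, fun e => hτ _ (hsig e), by simpa using h⟩
  · obtain ⟨sup, sig, hr, hsig, h⟩ := h.2 s e he
    exact ⟨_, _, hr.dual, fun e => hτ _ (hsig e), by rw [Interaction.app_dual, h, Option.map_none]⟩

/-! ### The regions of a word -/

section Outside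

variable {W : ℕ → ℕ} {e p s P n : ℕ}

theorem outside_self (h : p < s) : Outside W e p s s :=
  ⟨p, h, Or.inl rfl, fun r hr hpr => ⟨r, hr, hpr, rfl⟩⟩

theorem outside_succ : Outside W e p s (P + 1) ↔
    (W P = W p ∨ W P = e) ∨ (∃ r' < s, p < r' ∧ W r' = W P) ∧ Outside W e p s P := by
  constructor
  · rintro ⟨q, hq, h, hr⟩
    rcases Nat.lt_succ_iff_lt_or_eq.1 hq with hq | rfl
    · exact Or.inr ⟨hr P P.lt_succ_self hq, q, hq, h, fun r h1 => hr r (h1.trans P.lt_succ_self)⟩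
    · exact Or.inl h
  · rintro (h | ⟨hP, q, hq, h, hr⟩)
    · exact ⟨P, P.lt_succ_self, h, fun r h1 h2 => by omega⟩
    · refine ⟨q, hq.trans P.lt_succ_self, h, fun r h1 h2 => ?_⟩
      rcases Nat.lt_succ_iff_lt_or_eq.1 h1 with h1 | rfl
      · exact hr r h1 h2
      · exact hP

/-- One round of a cycle determines whether its end is outside: the last letter that leads in or out
occurs in every round. -/
theorem outside_add_self (hW : ∀ i < n, W (n + i) = W i) :
    Outside W e p s (n + n) ↔ Outside W e p s n := by
  constructor
  · rintro ⟨q, hq, h, hr⟩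
    rcases lt_or_ge q n with hqn | hqn
    · exact ⟨q, hqn, h, fun r h1 => hr r (by omega)⟩
    · obtain ⟨i, rfl⟩ := Nat.exists_eq_add_of_le hqn
      refine ⟨i, by omega, by rwa [hW i (by omega)] at h, fun r h1 h2 => ?_⟩
      rw [← hW r h1]
      exact hr (n + r) (by omega) (by omega)
  · rintro ⟨q, hq, h, hr⟩
    refine ⟨n + q, by omega, by rwa [hW q hq], fun r h1 h2 => ?_⟩
    obtain ⟨i, rfl⟩ := Nat.exists_eq_add_of_le (show n ≤ r by omega)
    rw [hW i (by omega)]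
    exact hr i (by omega) (by omega)

end Outside

/-- The properties of the word of a path or of a cycle with `n` states: the past of a cycle is
another round, and the past of a path has no letter in common with its arcs. -/
structure IsLinearWord (n : ℕ) (W : ℕ → ℕ) (cyc : Prop) : Prop where
  periodic : cyc → ∀ i < n, W (n + i) = W i
  past_ne : ¬ cyc → ∀ i < n, ∀ P, n ≤ P → P + 1 < n + n → W i ≠ W P

/-- The set of the positions `P` with `v P = true` is a region of a word, where the letter `k` has
the interaction `σ k`. In a path, the positions of the past and the last one have no arcs. -/
def IsWordRegion (n : ℕ) (W : ℕ → ℕ) (cyc : Prop) (σ : ℕ → Interaction) (v : ℕ → Bool) : Prop :=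
  ∀ P < n + n, cyc ∨ n ≤ P ∧ P + 1 < n + n → (σ (W P)).app (v P) = some (v (P + 1))

namespace IsWordRegion

variable {n : ℕ} {W : ℕ → ℕ} {cyc : Prop} {σ : ℕ → Interaction} {v : ℕ → Bool}

/-- For a region that does not contain the state at `s` but some other state, let `p` be the last
position before `s` where the region is left or `s` has no past. The letters between `p` and `s` do
not change the membership, so that the region contains no state that the criterion puts outside. -/
theorem exists_outside (hW : IsLinearWord n W cyc) (hv : IsWordRegion n W cyc σ v)
    (hper : cyc → ∀ i < n, v (n + i) = v i) (hswap : ∀ k, σ k ≠ .swap) {s P₀ : ℕ} (hns : n ≤ s)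
    (hs : s < n + n) (hvs : v s = false) (hP₀ : n ≤ P₀) (hP₀' : P₀ < n + n) (hvP₀ : v P₀ = true) :
    ∃ p < s, ((cyc ∨ n ≤ p) → σ (W p) = .inp ∨ σ (W p) = .res ∨ σ (W p) = .free) ∧
      ∀ e P, n ≤ P → P < n + n →
        (e = W p ∨ σ e = .inp ∧ ∃ P', n ≤ P' ∧ (cyc ∨ P' + 1 < n + n) ∧ W P' = e) →
        Outside W e p s P → v P = false := by
  classical
  -- `B p`: the region is left at the position `p`, or `p` belongs to the past of a path.
  set B : ℕ → Prop := fun p => (cyc ∨ n ≤ p) →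
    σ (W p) = .inp ∨ σ (W p) = .res ∨ σ (W p) = .free with hB
  have back : ∀ r < s, ¬ B r → v (r + 1) = false → v r = false ∧ σ (W r) = .nop := by
    intro r hr hBr h
    simp only [hB, Classical.not_imp] at hBr
    obtain ⟨h1, h2⟩ := hBr
    have h3 := hv r (by omega) (by
      rcases h1 with h1 | h1
      · exact Or.inl h1
      · exact Or.inr ⟨h1, by omega⟩)
    rw [h] at h3
    have h4 := hswap (W r)
    revert h2 h3 h4
    cases σ (W r) <;> cases v r <;> simp [Interaction.app]
  have back' : ∀ p ≤ s, (∀ r < s, p ≤ r → ¬ B r) → v p = false := by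
    intro p hp
    induction hp using Nat.decreasingInduction with
    | self => exact fun _ => hvs
    | of_succ k hk ih =>
      exact fun h => (back k hk (h k hk le_rfl) (ih fun r h1 h2 => h r h1 (by omega))).1
  obtain ⟨p, hps, hBp, hmax⟩ : ∃ p < s, B p ∧ ∀ r < s, p < r → ¬ B r := by
    have hex : ∃ p < s, B p := by
      by_cases hc : cyc
      · -- A cycle that is never left on the way to `s` does not meet the region at all.
        by_contra! hno
        have h : ∀ r ≤ s, v r = false := fun r hr => back' r hr fun r h1 _ => hno r h1
        rcases le_or_gt P₀ s with h1 | h1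
        · simp [h P₀ h1] at hvP₀
        · obtain ⟨i, rfl⟩ := Nat.exists_eq_add_of_le hP₀
          rw [hper hc i (by omega), h i (by omega)] at hvP₀
          cases hvP₀
      · exact ⟨n - 1, by omega, fun h => by
          rcases h with h | h
          · exact absurd h hc
          · omega⟩
    obtain ⟨p', hp', hBp'⟩ := hex
    have hle := Nat.le_findGreatest (P := fun p => p < s ∧ B p) hp'.le ⟨hp', hBp'⟩
    have hspec := Nat.findGreatest_spec (P := fun p => p < s ∧ B p) hp'.le ⟨hp', hBp'⟩
    exact ⟨_, hspec.1, hspec.2, fun r h1 h2 h3 => Nat.findGreatest_is_greatest h2 h1.le ⟨h1, h3⟩⟩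
  have hbetween : ∀ r < s, p < r → σ (W r) = .nop := fun r h1 h2 =>
    (back r h1 (hmax r h1 h2) (back' (r + 1) h1 fun r' h3 h4 => hmax r' h3 (by omega))).2
  refine ⟨p, hps, hBp, ?_⟩
  rintro e P hnP hP he ⟨q, hqP, hq, hr⟩
  -- In a path, no letter of the past occurs between `p` and `s`.
  have hqn : ¬ cyc → n ≤ q + 1 := by
    intro hc
    by_contra! hqn
    obtain ⟨r', h1, h2, h3⟩ := hr (n - 1) (by omega) (by omega)
    rcases lt_or_ge r' n with h4 | h4
    · exact hmax r' h1 h2 fun h => by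
        rcases h with h | h
        · exact absurd h hc
        · omega
    · exact hW.past_ne hc (n - 1) (by omega) r' h4 (by omega) h3.symm
  -- The occurrence of `W p` or of `e` leads out of the region, or it is the end of the past.
  have hstart : v (q + 1) = false := by
    by_cases hcq : cyc ∨ n ≤ q
    · have hstep := hv q (by omega) (hcq.imp_right fun h => ⟨h, by omega⟩)
      have hσ : σ (W q) = .inp ∨ σ (W q) = .res ∨ σ (W q) = .free := by
        have hp : W q = W p → σ (W q) = .inp ∨ σ (W q) = .res ∨ σ (W q) = .free := by
          intro h
          rw [h]
          refine hBp ?_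
          by_contra! hcp
          exact hW.past_ne hcp.1 p (by omega) q (hcq.resolve_left hcp.1) (by omega) h.symm
        rcases hq with hq | hq
        · exact hp hq
        · rcases he with he | he
          · exact hp (hq.trans he)
          · exact Or.inl (hq ▸ he.1)
      revert hstep
      rcases hσ with h | h | h <;> rw [h] <;> cases v q <;> simp [Interaction.app]
    · push Not at hcq
      have hqeq : q + 1 = n := le_antisymm hcq.2 (hqn hcq.1)
      have hWp : W q = W p := by
        rcases hq with hq | hq
        · exact hq
        · rcases he with he | ⟨-, P', h1, h2, h3⟩
          · exact hq.trans he
          · exact absurd (hq.trans h3.symm)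
              (hW.past_ne hcq.1 q hcq.2 P' h1 (h2.resolve_left hcq.1))
      have hpn : p < n := by
        by_contra! hpn
        exact hW.past_ne hcq.1 q hcq.2 p hpn (by omega) hWp
      exact back' (q + 1) (by omega) fun r h1 h2 => hmax r h1 (by omega)
  have hforward : ∀ P', q + 1 ≤ P' → P' ≤ P → v P' = false := by
    intro P' hqP'
    induction P', hqP' using Nat.le_induction with
    | base => exact fun _ => hstart
    | succ k hk ih =>
      intro hkP
      have hck : cyc ∨ n ≤ k := by
        by_cases hc : cyc
        · exact Or.inl hc
        · exact Or.inr ((hqn hc).trans hk)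
      have hstep := hv k (by omega) (hck.imp_right fun h => ⟨h, by omega⟩)
      obtain ⟨r', h1, h2, h3⟩ := hr k (by omega) (by omega)
      rw [← h3, hbetween r' h1 h2, ih (by omega)] at hstep
      exact (Option.some.inj hstep).symm
  exact hforward P (by omega) le_rfl

end IsWordRegion

/-! ### Regions of paths and cycles -/

/-- The word `W` spells the events of a path or cycle with the states `x`, from the position `n` on,
where `n` is the number of states. Before the position `n`, it spells another round of a cycle,
and it consists of symbols that are not events in case of a path. -/
structure IsWordOf (A : FinTS) (x W : ℕ → ℕ) (cyc : Prop) : Prop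
    extends IsLinear A x (fun i => W (A.n + i)) cyc where
  periodic : cyc → ∀ i < A.n, W (A.n + i) = W i
  le_past : ¬ cyc → ∀ i < A.n, A.m ≤ W i

namespace IsWordOf

variable {A : FinTS} {x W : ℕ → ℕ} {cyc : Prop}

theorem lt_m (h : IsWordOf A x W cyc) {P : ℕ} (hP : A.n ≤ P) (hP' : P < A.n + A.n)
    (hc : HasArc (A.n + A.n) cyc P) : W P < A.m := by
  obtain ⟨i, rfl⟩ := Nat.exists_eq_add_of_le hP
  exact (h.arc i (by omega) (hc.imp_left fun h => by omega)).lt.2.1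

theorem isLinearWord (h : IsWordOf A x W cyc) : IsLinearWord A.n W cyc where
  periodic := h.periodic
  past_ne hc i hi P hP hP' heq := by
    have h1 := h.le_past hc i hi
    have h2 := h.lt_m hP (by omega) (Or.inl (by omega))
    omega

theorem exists_isRegion (h : IsWordOf A x W cyc) {σ : ℕ → Interaction} {v : ℕ → Bool}
    (hv : ∀ P < A.n + A.n, A.n ≤ P → HasArc (A.n + A.n) cyc P →
      (σ (W P)).app (v P) = some (v (P + 1)))
    (hper : cyc → v (A.n + A.n) = v A.n) :
    ∃ sup, A.ts.IsRegion sup (fun e => σ e) ∧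
      ∀ c : Fin A.n, ∀ i < A.n, x i = c → sup c = v (A.n + i) := by
  choose i hi hx using h.surj
  have hix : ∀ c : Fin A.n, ∀ j < A.n, x j = c → i c c.2 = j := fun c j hj hj' =>
    h.inj _ (hi c c.2) j hj ((hx c c.2).trans hj'.symm)
  refine ⟨fun c => v (A.n + i c c.2), ?_, fun c j hj hj' =>
    congrArg (fun i => v (A.n + i)) (hix c j hj hj')⟩
  intro s e s' hse
  obtain ⟨j, hj, hjs⟩ := h.surj s s.2
  obtain ⟨hjn, hje⟩ := h.eq_of_arc j hj e s' ⟨s, e, s', hse, hjs.symm, rfl, rfl⟩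
  have harc := h.arc j hj hjn
  have hs' : x (j + 1) = s' := by
    obtain ⟨a, b, c, habc, ha, hb, hc⟩ := harc
    obtain rfl : a = s := Fin.ext (ha.trans hjs)
    obtain rfl : b = e := Fin.ext (hb.trans hje.symm)
    rw [← hc, Option.some.inj (habc.symm.trans hse)]
  have hvs' : v (A.n + i s' s'.2) = v (A.n + (j + 1)) := by
    rcases Nat.lt_or_ge (j + 1) A.n with hj1 | hj1
    · rw [hix s' _ hj1 hs']
    · have hcyc : cyc := hjn.resolve_left (by omega)
      obtain hjeq : j + 1 = A.n := by omega
      rw [hix s' 0 (by omega) (by rw [← hs', hjeq, h.closed hcyc]), hjeq, hper hcyc, add_zero]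
  change (σ e).app (v (A.n + i s s.2)) = some (v (A.n + i s' s'.2))
  rw [hix s j hj hjs, hvs', hje]
  exact hv (A.n + j) (by omega) (by omega) (hjn.imp_left fun h => by omega)

theorem exists_isWordRegion (h : IsWordOf A x W cyc) {sup : Fin A.n → Bool}
    {sig : Fin A.m → Interaction} (hr : A.ts.IsRegion sup sig) :
    ∃ σ v, IsWordRegion A.n W cyc σ v ∧ (cyc → ∀ i < A.n, v (A.n + i) = v i) ∧
      (∀ e : Fin A.m, σ e = sig e) ∧ (∀ k, σ k = .nop ∨ ∃ e, σ k = sig e) ∧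
      ∀ c : Fin A.n, ∀ i < A.n, x i = c → v (A.n + i) = sup c := by
  have hstep : ∀ s e s' (hs : s < A.n) (he : e < A.m) (hs' : s' < A.n), A.Arc s e s' →
      (sig ⟨e, he⟩).app (sup ⟨s, hs⟩) = some (sup ⟨s', hs'⟩) := by
    rintro _ _ _ hs he hs' ⟨a, b, c, habc, rfl, rfl, rfl⟩
    exact hr _ _ _ habc
  let u : ℕ → Bool := fun k => if hk : k < A.n then sup ⟨k, hk⟩ else false
  let σ : ℕ → Interaction := fun k => if hk : k < A.m then sig ⟨k, hk⟩ else .nop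
  have hσu : ∀ s e s', A.Arc s e s' → (σ e).app (u s) = some (u s') := by
    intro s e s' hse
    obtain ⟨h1, h2, h3⟩ := hse.lt
    simp only [σ, u, dif_pos h1, dif_pos h2, dif_pos h3]
    exact hstep _ _ _ _ _ _ hse
  refine ⟨σ, fun P => u (x (if P < A.n then P else P - A.n)), ?_, ?_, ?_, ?_, ?_⟩
  · intro P hP hc
    beta_reduce
    rcases lt_or_ge P A.n with hPn | hPn
    · have hcyc : cyc := hc.resolve_right (by omega)
      have := hσu _ _ _ (h.arc P hPn (Or.inr hcyc))
      rw [h.periodic hcyc P hPn] at this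
      rw [if_pos hPn, this]
      split_ifs with h1
      · rfl
      · obtain hP1 : P + 1 = A.n := by omega
        rw [hP1, Nat.sub_self, h.closed hcyc]
    · have := hσu _ _ _ (h.arc (P - A.n) (by omega)
        (hc.symm.imp_left fun h => by omega))
      rw [Nat.add_sub_cancel' hPn] at this
      rw [if_neg (by omega), if_neg (by omega), this, Nat.sub_add_comm hPn]
  · intro _ i hi
    simp [hi]
  · intro e
    simp [σ]
  · intro k
    by_cases hk : k < A.m
    · exact Or.inr ⟨⟨k, hk⟩, by simp [σ, hk]⟩
    · exact Or.inl (by simp [σ, hk])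
  · intro c i hi hic
    simp [u, hic]

open Classical in
/-- The region that consists of the states not outside, where `e` has a given interaction `ie`, the
letter `W p` leads out of the region, the letters between `p` and `s` do nothing, and all other
letters lead into the region. -/
theorem exists_isRegion_of_outside (h : IsWordOf A x W cyc) {rigid : Prop} {e₁ e p s : ℕ}
    {ie : Interaction} (he₁ : e₁ = W p ∨ e₁ = e)
    (hie : ∀ P < A.n + A.n, A.n ≤ P → HasArc (A.n + A.n) cyc P → W P = e →
      ie.app (decide ¬ Outside W e₁ p s P) = some (decide ¬ Outside W e₁ p s (P + 1)))
    (hrigid : ∀ P < A.n + A.n, A.n ≤ P → HasArc (A.n + A.n) cyc P → rigid ∧ W P = W p →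
      ¬ Outside W e₁ p s P) :
    ∃ sup sig, A.ts.IsRegion sup sig ∧ (∀ k : Fin A.m, (k : ℕ) = e → sig k = ie) ∧
      (∀ k, sig k = ie ∨ sig k = .nop ∨ sig k = .set ∨ sig k = if rigid then .inp else .res) ∧
      ∀ c : Fin A.n, ∀ i < A.n, x i = c → sup c = decide ¬ Outside W e₁ p s (A.n + i) := by
  let σ : ℕ → Interaction := fun k =>
    if k = e then ie
    else if k = W p then if rigid then .inp else .res
    else if ∃ r' < s, p < r' ∧ W r' = k then .nop else .set
  obtain ⟨sup, hsup, hsup'⟩ := h.exists_isRegion (σ := σ)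
    (v := fun P => decide ¬ Outside W e₁ p s P) (fun P hP hnP hc => by
      by_cases h1 : W P = e
      · simp only [σ, if_pos h1]
        exact hie P hP hnP hc h1
      have hsucc := @outside_succ W e₁ p s P
      by_cases h2 : W P = W p
      · simp only [σ, if_neg h1, if_pos h2]
        have hout : Outside W e₁ p s (P + 1) := hsucc.2 (Or.inl (Or.inl h2))
        split_ifs with h3
        · simp [Interaction.app, hrigid P hP hnP hc ⟨h3, h2⟩, hout]
        · simp [Interaction.app, hout]
      have h3 : ¬ (W P = W p ∨ W P = e₁) := by
        rintro (h3 | h3)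
        · exact h2 h3
        · exact he₁.elim (fun h4 => h2 (h3.trans h4)) fun h4 => h1 (h3.trans h4)
      rw [or_iff_right h3] at hsucc
      simp only [σ, if_neg h1, if_neg h2]
      split_ifs with h4
      · simp [Interaction.app, hsucc, h4]
      · have : ¬ Outside W e₁ p s (P + 1) := fun h5 => h4 (hsucc.1 h5).1
        simp [Interaction.app, this])
    (fun hc => by simp only [outside_add_self (h.periodic hc)])
  refine ⟨sup, _, hsup, fun k hk => if_pos hk, fun k => ?_, hsup'⟩
  simp only [σ]
  split_ifs <;> simp

open Classical in
theorem exists_isRegion_of_inpSep (h : IsWordOf A x W cyc) {rigid : Prop} {e j : ℕ}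
    (hj : j < A.n) (hs : InpSep rigid A.n (A.n + A.n) W cyc e (A.n + j)) :
    ∃ sup sig, A.ts.IsRegion sup sig ∧ (∀ k : Fin A.m, (k : ℕ) = e → sig k = .inp) ∧
      (∀ k, sig k = .inp ∨ sig k = .nop ∨ sig k = .set ∨ sig k = if rigid then .inp else .res) ∧
      ∀ c : Fin A.n, x j = c → sup c = false := by
  obtain ⟨p, hp, hs⟩ := hs
  obtain ⟨sup, sig, h1, h2, h3, h4⟩ := h.exists_isRegion_of_outside (rigid := rigid)
    (e₁ := e) (e := e) (p := p) (s := A.n + j) (ie := .inp) (Or.inr rfl)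
    (fun P hP hnP hc he => by
      have hout : Outside W e p (A.n + j) (P + 1) := outside_succ.2 (Or.inl (Or.inr he))
      simp [hs P hP hnP hc (Or.inl he), hout, Interaction.app])
    (fun P hP hnP hc hr => hs P hP hnP hc (Or.inr hr))
  exact ⟨sup, sig, h1, h2, h3, fun c hc => by simp [h4 c j hj hc, outside_self hp]⟩

open Classical in
theorem exists_isRegion_of_usedSep (h : IsWordOf A x W cyc) {rigid : Prop} {e j : ℕ}
    (hj : j < A.n) (hs : UsedSep rigid A.n (A.n + A.n) W cyc e (A.n + j)) :
    ∃ sup sig, A.ts.IsRegion sup sig ∧ (∀ k : Fin A.m, (k : ℕ) = e → sig k = .used) ∧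
      (∀ k, sig k = .used ∨ sig k = .nop ∨ sig k = .set ∨ sig k = if rigid then .inp else .res) ∧
      ∀ c : Fin A.n, x j = c → sup c = false := by
  obtain ⟨p, hp, hne, hs⟩ := hs
  obtain ⟨sup, sig, h1, h2, h3, h4⟩ := h.exists_isRegion_of_outside (rigid := rigid)
    (e₁ := W p) (e := e) (p := p) (s := A.n + j) (ie := .used) (Or.inl rfl)
    (fun P hP hnP hc he => by
      have h5 := hs P hP hnP hc (Or.inl he)
      have hout : ¬ Outside W (W p) p (A.n + j) (P + 1) := by
        rw [outside_succ, or_self, he]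
        rintro (h6 | h6)
        · exact hne h6.symm
        · exact h5 h6.2
      simp [h5, hout, Interaction.app])
    (fun P hP hnP hc hr => hs P hP hnP hc (Or.inr hr))
  exact ⟨sup, sig, h1, h2, h3, fun c hc => by simp [h4 c j hj hc, outside_self hp]⟩

open Classical in
theorem exists_isRegion_of_stateSep (h : IsWordOf A x W cyc) {rigid : Prop} {j j' : ℕ}
    (hj : j < A.n) (hj' : j' < A.n)
    (hs : StateSep rigid A.n (A.n + A.n) W cyc (A.n + j) (A.n + j')) :
    ∃ sup sig, A.ts.IsRegion sup sig ∧
      (∀ k, sig k = .nop ∨ sig k = .set ∨ sig k = if rigid then .inp else .res) ∧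
      (∀ c : Fin A.n, x j = c → sup c = false) ∧ ∀ c : Fin A.n, x j' = c → sup c = true := by
  obtain ⟨p, hp, hs, hs'⟩ := hs
  obtain ⟨sup, sig, h1, h2, h3, h4⟩ := h.exists_isRegion_of_outside (rigid := rigid)
    (e₁ := W p) (e := W p) (p := p) (s := A.n + j) (ie := if rigid then .inp else .res)
    (Or.inl rfl)
    (fun P hP hnP hc he => by
      have hout : Outside W (W p) p (A.n + j) (P + 1) := outside_succ.2 (Or.inl (Or.inr he))
      split_ifs with hr
      · simp [hs P hP hnP hc ⟨hr, he⟩, hout, Interaction.app]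
      · simp [hout, Interaction.app])
    hs
  exact ⟨sup, sig, h1, fun k => (h3 k).elim (fun h => Or.inr (Or.inr h)) id,
    fun c hc => by simp [h4 c j hj hc, outside_self hp],
    fun c hc => by simp [h4 c j' hj' hc, hs']⟩

end IsWordOf

/-! ### The criterion is necessary -/

namespace IsWordRegion

variable {n : ℕ} {W : ℕ → ℕ} {cyc : Prop} {σ : ℕ → Interaction} {v : ℕ → Bool} {rigid : Prop}
  {s P₀ : ℕ}

theorem step (hv : IsWordRegion n W cyc σ v) {P : ℕ} (hP : P < n + n) (hnP : n ≤ P)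
    (hc : HasArc (n + n) cyc P) : (σ (W P)).app (v P) = some (v (P + 1)) :=
  hv P hP (hc.symm.imp_right fun h => ⟨hnP, by omega⟩)

/-- An event that can only occur inside of the region. -/
theorem eq_true (hv : IsWordRegion n W cyc σ v) {P : ℕ} (hP : P < n + n) (hnP : n ≤ P)
    (hc : HasArc (n + n) cyc P) (h : σ (W P) = .inp ∨ σ (W P) = .used) : v P = true := by
  have := hv.step hP hnP hc
  revert this
  rcases h with h | h <;> rw [h] <;> cases v P <;> simp [Interaction.app]

theorem stateSep (hW : IsLinearWord n W cyc) (hv : IsWordRegion n W cyc σ v)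
    (hper : cyc → ∀ i < n, v (n + i) = v i) (hswap : ∀ k, σ k ≠ .swap)
    (hrigid : rigid → ∀ k, σ k ≠ .res ∧ σ k ≠ .free) (hns : n ≤ s)
    (hs : s < n + n) (hvs : v s = false) (hP₀ : n ≤ P₀) (hP₀' : P₀ < n + n) (hvP₀ : v P₀ = true) :
    StateSep rigid n (n + n) W cyc s P₀ := by
  obtain ⟨p, hp, hσ, hout⟩ := hv.exists_outside hW hper hswap hns hs hvs hP₀ hP₀' hvP₀
  refine ⟨p, hp, fun P hP hnP hc hr ho => ?_, fun ho => ?_⟩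
  · have h1 := hout _ P hnP hP (Or.inl rfl) ho
    rw [hv.eq_true hP hnP hc] at h1
    · cases h1
    · have hcp : cyc ∨ n ≤ p := by
        by_contra! hcp
        have := hc.resolve_right hcp.1
        exact hW.past_ne hcp.1 p hcp.2 P hnP (by omega) hr.2.symm
      have h2 := hσ hcp
      have h3 := hrigid hr.1 (W p)
      rw [hr.2]
      tauto
  · rw [hout _ P₀ hP₀ hP₀' (Or.inl rfl) ho] at hvP₀
    cases hvP₀

theorem inpSep (hW : IsLinearWord n W cyc) (hv : IsWordRegion n W cyc σ v)
    (hper : cyc → ∀ i < n, v (n + i) = v i) (hswap : ∀ k, σ k ≠ .swap)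
    (hrigid : rigid → ∀ k, σ k ≠ .res ∧ σ k ≠ .free) (hns : n ≤ s)
    (hs : s < n + n) (hvs : v s = false) (hP₀ : n ≤ P₀) (hP₀' : P₀ < n + n)
    (hc₀ : HasArc (n + n) cyc P₀) (hσ₀ : σ (W P₀) = .inp) :
    InpSep rigid n (n + n) W cyc (W P₀) s := by
  obtain ⟨p, hp, hσ, hout⟩ := hv.exists_outside hW hper hswap hns hs hvs hP₀ hP₀'
    (hv.eq_true hP₀' hP₀ hc₀ (Or.inl hσ₀))
  refine ⟨p, hp, fun P hP hnP hc hr ho => ?_⟩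
  have h1 := hout _ P hnP hP (Or.inr ⟨hσ₀, P₀, hP₀, hc₀.symm.imp_right fun h => by omega, rfl⟩) ho
  rw [hv.eq_true hP hnP hc] at h1
  · cases h1
  · rcases hr with hr | hr
    · exact Or.inl (hr ▸ hσ₀)
    · have hcp : cyc ∨ n ≤ p := by
        by_contra! hcp
        have := hc.resolve_right hcp.1
        exact hW.past_ne hcp.1 p hcp.2 P hnP (by omega) hr.2.symm
      have h2 := hσ hcp
      have h3 := hrigid hr.1 (W p)
      rw [hr.2]
      tauto

theorem usedSep (hW : IsLinearWord n W cyc) (hv : IsWordRegion n W cyc σ v)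
    (hper : cyc → ∀ i < n, v (n + i) = v i) (hswap : ∀ k, σ k ≠ .swap)
    (hrigid : rigid → ∀ k, σ k ≠ .res ∧ σ k ≠ .free) (hns : n ≤ s)
    (hs : s < n + n) (hvs : v s = false) (hP₀ : n ≤ P₀) (hP₀' : P₀ < n + n)
    (hc₀ : HasArc (n + n) cyc P₀) (hσ₀ : σ (W P₀) = .used) :
    UsedSep rigid n (n + n) W cyc (W P₀) s := by
  obtain ⟨p, hp, hσ, hout⟩ := hv.exists_outside hW hper hswap hns hs hvs hP₀ hP₀'
    (hv.eq_true hP₀' hP₀ hc₀ (Or.inr hσ₀))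
  have hpast : ∀ P < n + n, n ≤ P → HasArc (n + n) cyc P → W P = W p → cyc ∨ n ≤ p := by
    intro P hP hnP hc hr
    by_contra! hcp
    have := hc.resolve_right hcp.1
    exact hW.past_ne hcp.1 p hcp.2 P hnP (by omega) hr.symm
  refine ⟨p, hp, fun heq => ?_, fun P hP hnP hc hr ho => ?_⟩
  · have := hσ (hpast P₀ hP₀' hP₀ hc₀ heq.symm)
    rw [heq, hσ₀] at this
    simp at this
  have h1 := hout _ P hnP hP (Or.inl rfl) ho
  rw [hv.eq_true hP hnP hc] at h1
  · cases h1
  · rcases hr with hr | hr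
    · exact Or.inr (hr ▸ hσ₀)
    · have h2 := hσ (hpast P hP hnP hc hr.2)
      have h3 := hrigid hr.1 (W p)
      rw [hr.2]
      tauto

end IsWordRegion

/-! ### Solvability and the criterion -/

/-- In a path or in a cycle, an arc starts at each position but the last one of a path. -/
theorem IsWordOf.δ_eq_none_iff {A : FinTS} {x W : ℕ → ℕ} {cyc : Prop} (h : IsWordOf A x W cyc)
    {j : ℕ} (hj : j < A.n) (c : Fin A.n) (hc : x j = c) (e : Fin A.m) :
    A.ts.δ c e = none ↔ ¬ (HasArc (A.n + A.n) cyc (A.n + j) ∧ W (A.n + j) = e) := by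
  constructor
  · rintro hδ ⟨h1, h2⟩
    obtain ⟨a, b, d, habd, ha, hb, -⟩ := h.arc j hj (h1.imp_left fun h => by omega)
    obtain rfl : a = c := Fin.ext (ha.trans hc)
    obtain rfl : b = e := Fin.ext (hb.trans h2)
    rw [hδ] at habd
    cases habd
  · intro hno
    cases hδ : A.ts.δ c e with
    | none => rfl
    | some d =>
      obtain ⟨h1, h2⟩ := h.eq_of_arc j hj e d ⟨c, e, d, hδ, hc.symm, rfl, rfl⟩
      exact absurd ⟨h1.imp_left fun h => by omega, h2.symm⟩ hno

/-- The types of nets that the criterion applies to. In the rigid case, regions can only be left by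
`inp`, which restricts the events that leave them to occur inside of the region only. Otherwise,
`res` leaves a region without any restriction. In both cases some interaction is partial, so that
events can be prevented at all. -/
structure IsAdmissible (rigid : Prop) (τ : Set Interaction) : Prop where
  nop : .nop ∈ τ
  set : .set ∈ τ
  swap : .swap ∉ τ
  of_rigid : rigid → .inp ∈ τ ∧ .out ∉ τ ∧ .res ∉ τ ∧ .free ∉ τ
  res : ¬ rigid → .res ∈ τ
  exists_partial : .inp ∈ τ ∨ .out ∈ τ ∨ .used ∈ τ ∨ .free ∈ τ

namespace IsAdmissible

variable {A : FinTS} {x W : ℕ → ℕ} {cyc rigid : Prop} {τ : Set Interaction}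

open Classical in
theorem exit_mem (hτ : IsAdmissible rigid τ) : (if rigid then .inp else .res) ∈ τ := by
  split_ifs with h
  · exact (hτ.of_rigid h).1
  · exact hτ.res h

theorem accept_of_solvable (hτ : IsAdmissible rigid τ) (h : IsWordOf A x W cyc)
    (hA : A.ts.Solvable τ) :
    Accept rigid (.inp ∈ τ ∨ .out ∈ τ) (.used ∈ τ ∨ .free ∈ τ) A.n (A.n + A.n) W cyc := by
  rw [InitTS.solvable_iff] at hA
  have hW := h.isLinearWord
  have hstate : ∀ s < A.n + A.n, A.n ≤ s → ∃ c : Fin A.n, x (s - A.n) = c := fun s hs hs' =>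
    ⟨⟨x (s - A.n), h.lt _ (by omega)⟩, rfl⟩
  have hmem : ∀ {σ : ℕ → Interaction} {sig : Fin A.m → Interaction}, (∀ e, sig e ∈ τ) →
      (∀ k, σ k = .nop ∨ ∃ e, σ k = sig e) → ∀ k, σ k ∈ τ := by
    intro σ sig hsig hσ k
    rcases hσ k with hk | ⟨e, hk⟩
    · exact hk ▸ hτ.nop
    · exact hk ▸ hsig e
  have hrig : ∀ {σ : ℕ → Interaction}, (∀ k, σ k ∈ τ) →
      rigid → ∀ k, σ k ≠ .res ∧ σ k ≠ .free := fun hσ hr k =>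
    ⟨fun hk => (hτ.of_rigid hr).2.2.1 (hk ▸ hσ k), fun hk => (hτ.of_rigid hr).2.2.2 (hk ▸ hσ k)⟩
  refine ⟨fun s hs hns s' hs' hns' hss' => ?_, fun P hP hnP hc s hs hns hno => ?_⟩
  · obtain ⟨c, hcs⟩ := hstate s hs hns
    obtain ⟨c', hcs'⟩ := hstate s' hs' hns'
    have hcc' : c ≠ c' := by
      rintro rfl
      have := h.inj _ (by omega) _ (by omega) (hcs.trans hcs'.symm)
      omega
    obtain ⟨sup, sig, hr, hsig, hsep⟩ := hA.1 c c' hcc'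
    obtain ⟨σ, v, hv, hper, -, hσ, hvx⟩ := h.exists_isWordRegion hr
    have hvs := hvx c _ (by omega) hcs
    have hvs' := hvx c' _ (by omega) hcs'
    rw [Nat.add_sub_cancel' hns] at hvs
    rw [Nat.add_sub_cancel' hns'] at hvs'
    have hσ := hmem hsig hσ
    have hswap : ∀ k, σ k ≠ .swap := fun k hk => hτ.swap (hk ▸ hσ k)
    cases h1 : sup c <;> cases h2 : sup c'
    · exact absurd (h1.trans h2.symm) hsep
    · exact Or.inl (hv.stateSep hW hper hswap (hrig hσ) hns hs (hvs.trans h1) hns' hs'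
        (hvs'.trans h2))
    · exact Or.inr (hv.stateSep hW hper hswap (hrig hσ) hns' hs' (hvs'.trans h2) hns hs
        (hvs.trans h1))
    · exact absurd (h1.trans h2.symm) hsep
  · obtain ⟨c, hcs⟩ := hstate s hs hns
    have he : W P < A.m := h.lt_m hnP hP hc
    have hδ : A.ts.δ c ⟨W P, he⟩ = none := by
      rw [h.δ_eq_none_iff (j := s - A.n) (by omega) c hcs, Nat.add_sub_cancel' hns]
      exact hno
    obtain ⟨sup, sig, hr, hsig, hsep⟩ := hA.2 c _ hδ
    -- A region that prevents an event by `out` or `free` is replaced by its complement.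
    obtain ⟨sup, sig, hr, hswap, hrig', hsup, hcase⟩ : ∃ sup sig, A.ts.IsRegion sup sig ∧
        (∀ e, sig e ≠ .swap) ∧ (rigid → ∀ e, sig e ≠ .res ∧ sig e ≠ .free) ∧ sup c = false ∧
        ((.inp ∈ τ ∨ .out ∈ τ) ∧ sig ⟨W P, he⟩ = .inp ∨
          (.used ∈ τ ∨ .free ∈ τ) ∧ sig ⟨W P, he⟩ = .used) := by
      have hsw : ∀ e, sig e ≠ .swap := fun e he => hτ.swap (he ▸ hsig e)
      have hri : rigid → ∀ e, sig e ≠ .res ∧ sig e ≠ .free := fun hr e =>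
        ⟨fun h => (hτ.of_rigid hr).2.2.1 (h ▸ hsig e), fun h => (hτ.of_rigid hr).2.2.2 (h ▸ hsig e)⟩
      have hdsw : ∀ e, (sig e).dual ≠ .swap := fun e he => hsw e <| by
        rw [← Interaction.dual_dual (sig e), he]
        rfl
      have hτe := hsig ⟨W P, he⟩
      cases hs : sig ⟨W P, he⟩ <;> cases hc : sup c <;> rw [hs] at hτe <;> rw [hs, hc] at hsep <;>
        simp only [Interaction.app, reduceCtorEq] at hsep
      · exact ⟨sup, sig, hr, hsw, hri, hc, Or.inl ⟨Or.inl hτe, hs⟩⟩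
      · exact ⟨_, _, hr.dual, hdsw, fun hr => absurd hτe (hτ.of_rigid hr).2.1, by simp [hc],
          Or.inl ⟨Or.inr hτe, by rw [hs]; rfl⟩⟩
      · exact ⟨sup, sig, hr, hsw, hri, hc, Or.inr ⟨Or.inl hτe, hs⟩⟩
      · exact ⟨_, _, hr.dual, hdsw, fun hr => absurd hτe (hτ.of_rigid hr).2.2.2, by simp [hc],
          Or.inr ⟨Or.inr hτe, by rw [hs]; rfl⟩⟩
    obtain ⟨σ, v, hv, hper, hσsig, hσ, hvx⟩ := h.exists_isWordRegion hr
    have hvs := hvx c _ (by omega) hcs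
    rw [Nat.add_sub_cancel' hns] at hvs
    have hswap' : ∀ k, σ k ≠ .swap := by
      intro k
      rcases hσ k with hk | ⟨e, hk⟩ <;> rw [hk]
      · decide
      · exact hswap e
    have hrig'' : rigid → ∀ k, σ k ≠ .res ∧ σ k ≠ .free := by
      intro hr k
      rcases hσ k with hk | ⟨e, hk⟩ <;> rw [hk]
      · decide
      · exact hrig' hr e
    have hσP := hσsig ⟨W P, he⟩
    refine hcase.imp (fun hcase => ⟨hcase.1, ?_⟩) (fun hcase => ⟨hcase.1, ?_⟩)
    · exact hv.inpSep hW hper hswap' hrig'' hns hs (hvs.trans hsup) hnP hP hc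
        (hσP.trans hcase.2)
    · exact hv.usedSep hW hper hswap' hrig'' hns hs (hvs.trans hsup) hnP hP hc
        (hσP.trans hcase.2)

/-- An event without arcs is prevented by the region without states or by the region of all
states. -/
theorem exists_isRegion_of_not_occurs {S E : Type} {A : InitTS S E} (hτ : IsAdmissible rigid τ)
    {e : E} (he : ∀ s, A.δ s e = none) (s : S) :
    ∃ sup sig, A.IsRegion sup sig ∧ (∀ e, sig e ∈ τ) ∧ (sig e).app (sup s) = none := by
  classical
  have key : ∀ (b : Bool) (i : Interaction), i ∈ τ → i.app b = none →
      ∃ sup sig, A.IsRegion sup sig ∧ (∀ e, sig e ∈ τ) ∧ (sig e).app (sup s) = none := by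
    intro b i hi hib
    refine ⟨fun _ => b, fun k => if k = e then i else .nop, fun s₁ k s₂ h => ?_, fun k => ?_, ?_⟩
    · have hk : k ≠ e := by
        rintro rfl
        rw [he s₁] at h
        cases h
      simp [hk, Interaction.app]
    · dsimp only
      split_ifs
      · exact hi
      · exact hτ.nop
    · simpa using hib
  rcases hτ.exists_partial with h | h | h | h
  · exact key false _ h rfl
  · exact key true _ h rfl
  · exact key false _ h rfl
  · exact key true _ h rfl

open Classical in
/-- A region obtained from the criterion, or its complement, prevents the event. -/
theorem exists_isRegion_of_prevents {S E : Type} {A : InitTS S E} (hτ : IsAdmissible rigid τ)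
    {sup : S → Bool} {sig : E → Interaction} {i : Interaction} (hr : A.IsRegion sup sig)
    (hsig : ∀ k, sig k = i ∨ sig k = .nop ∨ sig k = .set ∨ sig k = if rigid then .inp else .res)
    {e : E} (he : sig e = i) {s : S} (hs : sup s = false) (hi : i.app false = none)
    (hiτ : i ∈ τ ∨ i.dual ∈ τ ∧ ¬ rigid) :
    ∃ sup sig, A.IsRegion sup sig ∧ (∀ e, sig e ∈ τ) ∧ (sig e).app (sup s) = none := by
  rcases hiτ with hiτ | ⟨hiτ, hrig⟩
  · refine ⟨sup, sig, hr, fun k => ?_, by rw [he, hs, hi]⟩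
    rcases hsig k with h | h | h | h <;> rw [h]
    · exact hiτ
    · exact hτ.nop
    · exact hτ.set
    · exact hτ.exit_mem
  · refine ⟨_, _, hr.dual, fun k => ?_, by rw [Interaction.app_dual, he, hs, hi, Option.map_none]⟩
    rcases hsig k with h | h | h | h <;> rw [h]
    · exact hiτ
    · exact hτ.nop
    · exact hτ.res hrig
    · rw [if_neg hrig]
      exact hτ.set

theorem solvable_of_accept (hτ : IsAdmissible rigid τ) (h : IsWordOf A x W cyc)
    (hA : Accept rigid (.inp ∈ τ ∨ .out ∈ τ) (.used ∈ τ ∨ .free ∈ τ) A.n (A.n + A.n) W cyc) :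
    A.ts.Solvable τ := by
  rw [InitTS.solvable_iff]
  refine ⟨fun s s' hss' => ?_, fun s e hse => ?_⟩
  · obtain ⟨j, hj, hjs⟩ := h.surj s s.2
    obtain ⟨j', hj', hjs'⟩ := h.surj s' s'.2
    have hjj' : j ≠ j' := by
      rintro rfl
      exact hss' (Fin.ext (hjs.symm.trans hjs'))
    rcases hA.1 (A.n + j) (by omega) (by omega) (A.n + j') (by omega) (by omega) (by omega)
      with hsep | hsep
    · obtain ⟨sup, sig, hr, hsig, h1, h2⟩ := h.exists_isRegion_of_stateSep hj hj' hsep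
      refine ⟨sup, sig, hr, fun k => ?_, by rw [h1 s hjs, h2 s' hjs']; decide⟩
      rcases hsig k with h | h | h <;> rw [h]
      exacts [hτ.nop, hτ.set, hτ.exit_mem]
    · obtain ⟨sup, sig, hr, hsig, h1, h2⟩ := h.exists_isRegion_of_stateSep hj' hj hsep
      refine ⟨sup, sig, hr, fun k => ?_, by rw [h1 s' hjs', h2 s hjs]; decide⟩
      rcases hsig k with h | h | h <;> rw [h]
      exacts [hτ.nop, hτ.set, hτ.exit_mem]
  · by_cases hocc : ∀ s, A.ts.δ s e = none
    · exact hτ.exists_isRegion_of_not_occurs hocc s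
    push Not at hocc
    obtain ⟨s₁, hs₁⟩ := hocc
    obtain ⟨i, hi, his⟩ := h.surj s₁ s₁.2
    have harc : HasArc (A.n + A.n) cyc (A.n + i) ∧ W (A.n + i) = e := by
      by_contra hno
      exact hs₁ ((h.δ_eq_none_iff hi s₁ his e).2 hno)
    obtain ⟨j, hj, hjs⟩ := h.surj s s.2
    have hno := (h.δ_eq_none_iff hj s hjs e).1 hse
    rw [← harc.2] at hno
    rcases hA.2 (A.n + i) (by omega) (by omega) harc.1 (A.n + j) (by omega) (by omega) hno
      with ⟨huse, hsep⟩ | ⟨huse, hsep⟩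
    · rw [harc.2] at hsep
      obtain ⟨sup, sig, hr, h1, hsig, h2⟩ := h.exists_isRegion_of_inpSep hj hsep
      exact hτ.exists_isRegion_of_prevents hr hsig (h1 e rfl) (h2 s hjs) rfl
        (huse.imp_right fun h => ⟨h, fun hr => (hτ.of_rigid hr).2.1 h⟩)
    · rw [harc.2] at hsep
      obtain ⟨sup, sig, hr, h1, hsig, h2⟩ := h.exists_isRegion_of_usedSep hj hsep
      exact hτ.exists_isRegion_of_prevents hr hsig (h1 e rfl) (h2 s hjs) rfl
        (huse.imp_right fun h => ⟨h, fun hr => (hτ.of_rigid hr).2.2.2 h⟩)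

end IsAdmissible

/-! ### The decision procedure -/

/-- The word that is computed from the encoding of a path or of a cycle. -/
theorem isWordOf_encode {A : FinTS} (hA : A.ts.IsBounded 1) :
    IsWordOf A (stateAt A.encode) (letter A.encode) (IsCycle A.encode) := by
  have hlin := FinTS.isLinear_encode hA
  have hev : ∀ i, letter A.encode (A.n + i) = eventAt A.encode (stateAt A.encode i) := by
    intro i
    rw [letter, FinTS.numStates_encode, if_neg (by omega), Nat.add_sub_cancel_left]
  refine { toIsLinear := ?_, periodic := fun hc i hi => ?_, le_past := fun hc i hi => ?_ }
  · simpa only [hev] using hlin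
  · rw [hev, letter, FinTS.numStates_encode, if_pos hi, if_pos hc]
  · rw [letter, FinTS.numStates_encode, if_pos hi, if_neg hc]
    have := A.le_length_encode
    omega

theorem IsAdmissible.solvable_iff {A : FinTS} {rigid : Prop} {τ : Set Interaction}
    (hτ : IsAdmissible rigid τ) (hA : A.ts.IsBounded 1) :
    A.ts.Solvable τ ↔ Accept rigid (.inp ∈ τ ∨ .out ∈ τ) (.used ∈ τ ∨ .free ∈ τ)
      (numStates A.encode) (endPos A.encode) (letter A.encode) (IsCycle A.encode) := by
  rw [FinTS.numStates_encode, FinTS.endPos_encode]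
  exact ⟨hτ.accept_of_solvable (isWordOf_encode hA), hτ.solvable_of_accept (isWordOf_encode hA)⟩

theorem IsAdmissible.polyTimeDecidable {rigid : Prop} {τ : Set Interaction}
    (hτ : IsAdmissible rigid τ) {g : ℕ} (hg : g ≤ 1) :
    PolyTimeDecidable (fun A : {A : FinTS // A.ts.IsBounded g} => A.1.encode)
      fun A => A.1.ts.Solvable τ := by
  refine PT.polyTimeDecidable
    (PTP.accept rigid (.inp ∈ τ ∨ .out ∈ τ) (.used ∈ τ ∨ .free ∈ τ))
    (fun A => A.1.encode_ne_nil) fun A => ?_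
  have hA : A.1.ts.IsBounded 1 := fun s =>
    ⟨(A.2 s).1.trans (by exact_mod_cast hg), (A.2 s).2.trans (by exact_mod_cast hg)⟩
  rw [hτ.solvable_iff hA]
  split_ifs with h <;> simp [h]

/-- The regions of a type are the complements of the regions of the dual type. -/
theorem solvable_iff_of_dual {A : FinTS} {τ τ' : Set Interaction} (h : ∀ i ∈ τ, i.dual ∈ τ')
    (h' : ∀ i ∈ τ', i.dual ∈ τ) : A.ts.Solvable τ ↔ A.ts.Solvable τ' :=
  ⟨InitTS.Solvable.dual h, InitTS.Solvable.dual h'⟩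

theorem isAdmissible_of_res {ω : Set Interaction} (hω : ω.Nonempty)
    (hω' : ω ⊆ {.inp, .out, .used, .free}) :
    IsAdmissible False ({.nop, .set, .res} ∪ ω) where
  nop := by simp
  set := by simp
  swap h := by
    rcases h with h | h
    · simp at h
    · simpa using hω' h
  of_rigid h := h.elim
  res _ := by simp
  exists_partial := by
    obtain ⟨i, hi⟩ := hω
    have := hω' hi
    simp only [Set.mem_insert_iff, Set.mem_singleton_iff] at this
    rcases this with rfl | rfl | rfl | rfl <;> simp [hi]

end BoolNet

theorem mainTheorem8 (g : ℕ) (hg : g < 2) (τ : Set BoolNet.Interaction)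
    (hτ : τ = {.nop, .inp, .set} ∨
      τ = {.nop, .inp, .set, .used} ∨
      τ = {.nop, .out, .res} ∨
      τ = {.nop, .out, .res, .free} ∨
      ∃ ω : Set BoolNet.Interaction, ω.Nonempty ∧ ω ⊆ {.inp, .out, .used, .free} ∧
        τ = {.nop, .set, .res} ∪ ω) :
    BoolNet.PolyTimeDecidable
      (fun A : {A : BoolNet.FinTS // A.ts.IsBounded g} => A.1.encode)
      (fun A => A.1.ts.Solvable τ) := by
  have hg : g ≤ 1 := by omega
  have h₃ : BoolNet.IsAdmissible True {.nop, .inp, .set} := by constructor <;> simp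
  have h₄ : BoolNet.IsAdmissible True {.nop, .inp, .set, .used} := by constructor <;> simp
  rcases hτ with rfl | rfl | rfl | rfl | ⟨ω, hω, hω', rfl⟩
  · exact h₃.polyTimeDecidable hg
  · exact h₄.polyTimeDecidable hg
  · have h := h₃.polyTimeDecidable hg
    simpa only [BoolNet.solvable_iff_of_dual (τ := {.nop, .inp, .set}) (τ' := {.nop, .out, .res})
      (by simp [BoolNet.Interaction.dual]) (by simp [BoolNet.Interaction.dual])] using h
  · have h := h₄.polyTimeDecidable hg
    simpa only [BoolNet.solvable_iff_of_dual (τ := {.nop, .inp, .set, .used})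
      (τ' := {.nop, .out, .res, .free})
      (by simp [BoolNet.Interaction.dual]) (by simp [BoolNet.Interaction.dual])] using h
  · exact (BoolNet.isAdmissible_of_res hω hω').polyTimeDecidable hg
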